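/- \textbf{Setting.} Let $A\in\mathbb{R}^{m\times n}$, $m\ge n$, have the singular value decomposition $A=U\begin{pmatrix}\Sigma\\ 0\end{pmatrix}V^T$ with $U=(u_1,\dots,u_m)$ and $V=(v_1,\dots,v_n)$ orthogonal, $\Sigma=\mathrm{diag}(\sigma_1,\dots,\sigma_n)$ and simple singular values $\sigma_1>\sigma_2>\cdots>\sigma_n>0$. Let $b=\hat b+e\in\mathbb{R}^m$. Assume the model discrete Picard condition $|u_j^T\hat b|=\sigma_j^{1+\beta}$, $j=1,\dots,n$, with some $\beta>0$, and the idealized noise model with noise level $\eta>0$ and transition index $1\le k_0\le n$: $$|u_j^Tb|=|u_j^T\hat b|\ (1\le j\le k_0),\qquad |u_j^Tb|=\eta\ (k_0<j\le n),\qquad |u_{j+1}^Tb|\le|u_j^Tb|\ (1\le j\le n-1).$$ Lanczos bidiagonalization starts with $p_1=b/\|b\|$, $\beta_1q_0=0$ and computes for $j=1,2,\dots$: $r=A^Tp_j-\beta_jq_{j-1}$, $\alpha_j=\|r\|$, $q_j=r/\alpha_j$, $z=Aq_j-\alpha_jp_j$, $\beta_{j+1}=\|z\|$, $p_{j+1}=z/\beta_{j+1}$.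 Let $P_{k+1}=(p_1,\dots,p_{k+1})$, $Q_k=(q_1,\dots,q_k)$, let $B_k\in\mathbb{R}^{(k+1)\times k}$ be lower bidiagonal with diagonal $\alpha_1,\dots,\alpha_k$ and subdiagonal $\beta_2,\dots,\beta_{k+1}$, and let $\gamma_k=\|A-P_{k+1}B_kQ_k^T\|$ (2-norm). For $1\le k\le n-1$ let $\Sigma_k=\mathrm{diag}(\sigma_1,\dots,\sigma_k)$, $\Delta_k=D_2T_{k2}T_{k1}^{-1}D_1^{-1}\in\mathbb{R}^{(n-k)\times k}$, where $D_1=\mathrm{diag}(\sigma_iu_i^Tb)_{i\le k}$, $D_2=\mathrm{diag}(\sigma_iu_i^Tb)_{k<i\le n}$, and $T_{k1}$, $T_{k2}$ consist of the rows $i\le k$ and $k<i\le n$ of the matrix with rows $(1,\sigma_i^2,\dots,\sigma_i^{2k-2})$. Put $$|L_{k_1}^{(k)}(0)|=\max_{1\le j\le k}\ \prod_{1\le i\le k,\ i\ne j}\frac{\sigma_i^2}{|\sigma_j^2-\sigma_i^2|},\qquad \xi_k=\sqrt{\|\Delta_k(I+\Delta_k^T\Delta_k)^{-1}\|^2+1},$$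 $$\eta_k=\frac{1}{\sigma_{k+1}}\sqrt{\|\Sigma_k(I+\Delta_k^T\Delta_k)^{-1}\Delta_k^T\Delta_k\|^2+\|\Sigma_k(I+\Delta_k^T\Delta_k)^{-1}\Delta_k^T\|^2}.$$ \textbf{Theorem.} (i) For $k=1,\dots,n-1$, $$\sigma_{k+1}\le\gamma_k\le\sqrt{1+\eta_k^2}\,\sigma_{k+1},$$ and $\xi_k=\sqrt{\left(\frac{\|\Delta_k\|}{1+\|\Delta_k\|^2}\right)^2+1}$ if $\|\Delta_k\|<1$, while $\xi_k\le\frac{\sqrt5}{2}$ if $\|\Delta_k\|\ge1$. (ii) Severely ill-posed problems, $\sigma_j=\mathcal{O}(\rho^{-j})$: for all $\kappa\ge1$ and $0<\delta<1$ there is a constant $C=C(\kappa,\delta)>0$ such that, whenever $\rho>1$, $\sigma_{j+d}\le\kappa\rho^{-d}\sigma_j$ for all $j\ge1$, $d\ge0$, $j+d\le n$, and $\sigma_{j+1}\le\delta\sigma_j$ for $1\le j\le n-1$, then for $k=1,\dots,n-1$ $$\eta_k\le\begin{cases}\xi_k\dfrac{|u_{k+1}^Tb|}{|u_k^Tb|}\,(1+C\rho^{-2}),&1\le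 k\le k_0,\\[2mm] \xi_k\sqrt{k-k_0+1}\,(1+C\rho^{-2}),&k_0<k\le n-1.\end{cases}$$ The constant $C$ depends on nothing else (in particular not on $m,n,k,k_0,\rho,\beta,\eta,A,b$). Every strictly decreasing positive sequence $\sigma_1,\dots,\sigma_n$ satisfies the two conditions for some $\kappa$ and $\delta$. (iii) Moderately or mildly ill-posed problems, $\sigma_j=\zeta j^{-\alpha}$ for $j=1,\dots,n$ with $\zeta>0$, $\alpha>\frac12$: for $k=1,\dots,n-1$ $$\eta_k\le\begin{cases}\xi_1\dfrac{\sigma_1}{\sigma_2}\dfrac{|u_2^Tb|}{|u_1^Tb|}\sqrt{\dfrac1{2\alpha-1}},&k=1,\\[2mm] \xi_k\dfrac{\sigma_k}{\sigma_{k+1}}\dfrac{|u_{k+1}^Tb|}{|u_k^Tb|}\sqrt{\dfrac{k^2}{4\alpha^2-1}+\dfrac{k}{2\alpha-1}}\;|L_{k_1}^{(k)}(0)|,&1<k\le k_0,\\[2mm] \xi_k\dfrac{\sigma_k}{\sigma_{k+1}}\sqrt{\dfrac{kk_0}{4\alpha^2-1}+\dfrac{k(k-k_0+1)}{2\alpha-1}}\;|L_{k_1}^{(k)}(0)|,&k_0<k\le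 n-1.\end{cases}$$ -/

import Mathlib

open scoped Matrix Matrix.Norms.L2Operator

-- In this file `‖·‖` on matrices is the 2-norm (largest singular value), from the scope
-- `Matrix.Norms.L2Operator`.  Scalar sequences are indexed from `1`, as `σ_1, σ_2, …`; a column
-- or row with one-based number `j` has the `Fin` index `j - 1`.

noncomputable section

/-- State of Lanczos bidiagonalization after `j` steps: the vectors `p_{j+1}` and `q_j`
and the scalars `α_j` and `β_{j+1}`. -/
structure LanczosState (m n : ℕ) where
  p : EuclideanSpace ℝ (Fin m)
  q : EuclideanSpace ℝ (Fin n)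
  alpha : ℝ
  beta : ℝ

/-- One step of the process: `r = Aᵀ p_j - β_j q_{j-1}`, `α_j = ‖r‖`, `q_j = r / α_j`,
`z = A q_j - α_j p_j`, `β_{j+1} = ‖z‖`, `p_{j+1} = z / β_{j+1}`. -/
def lanczosStep {m n : ℕ} (A : Matrix (Fin m) (Fin n) ℝ) (s : LanczosState m n) :
    LanczosState m n :=
  let r := Matrix.toEuclideanLin Aᵀ s.p - s.beta • s.q
  let a := ‖r‖
  let q' := a⁻¹ • r
  let z := Matrix.toEuclideanLin A q' - a • s.p
  { p := ‖z‖⁻¹ • z, q := q', alpha := a, beta := ‖z‖ }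

/-- Lanczos bidiagonalization started with `p_1 = b / ‖b‖` and `β_1 q_0 = 0`. -/
def lanczos {m n : ℕ} (A : Matrix (Fin m) (Fin n) ℝ) (b : EuclideanSpace ℝ (Fin m)) :
    ℕ → LanczosState m n
  | 0 => { p := ‖b‖⁻¹ • b, q := 0, alpha := 0, beta := 0 }
  | j + 1 => lanczosStep A (lanczos A b j)

/-- `P_{k+1} = (p_1, …, p_{k+1})`. -/
def lanczosP {m n : ℕ} (A : Matrix (Fin m) (Fin n) ℝ) (b : EuclideanSpace ℝ (Fin m)) (k : ℕ) :
    Matrix (Fin m) (Fin (k + 1)) ℝ :=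
  Matrix.of fun i j => (lanczos A b j).p i

/-- `Q_k = (q_1, …, q_k)`. -/
def lanczosQ {m n : ℕ} (A : Matrix (Fin m) (Fin n) ℝ) (b : EuclideanSpace ℝ (Fin m)) (k : ℕ) :
    Matrix (Fin n) (Fin k) ℝ :=
  Matrix.of fun i j => (lanczos A b (j + 1)).q i

/-- The lower bidiagonal `(k+1) × k` matrix `B_k` with diagonal `α_1, …, α_k` and
subdiagonal `β_2, …, β_{k+1}`. -/
def lanczosB {m n : ℕ} (A : Matrix (Fin m) (Fin n) ℝ) (b : EuclideanSpace ℝ (Fin m)) (k : ℕ) :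
    Matrix (Fin (k + 1)) (Fin k) ℝ :=
  Matrix.of fun i j =>
    if (i : ℕ) = j then (lanczos A b (j + 1)).alpha
    else if (i : ℕ) = j + 1 then (lanczos A b (j + 1)).beta
    else 0

/-- `γ_k = ‖A - P_{k+1} B_k Q_kᵀ‖`. -/
def lanczosError {m n : ℕ} (A : Matrix (Fin m) (Fin n) ℝ) (b : EuclideanSpace ℝ (Fin m))
    (k : ℕ) : ℝ :=
  ‖A - lanczosP A b k * lanczosB A b k * (lanczosQ A b k)ᵀ‖

/-- `u_jᵀ b`, where `u_j` is the `j`-th column of `U`, `1 ≤ j ≤ m`. -/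
def colInner {m : ℕ} (U : Matrix (Fin m) (Fin m) ℝ) (b : EuclideanSpace ℝ (Fin m)) (j : ℕ) : ℝ :=
  if h : j - 1 < m then ∑ i, U i ⟨j - 1, h⟩ * b i else 0

/-- The `m × n` matrix `(Σ; 0)` with `Σ = diag(σ_1, …, σ_n)`. -/
def sigmaMatrix (m n : ℕ) (σ : ℕ → ℝ) : Matrix (Fin m) (Fin n) ℝ :=
  Matrix.of fun i j => if (i : ℕ) = j then σ (j + 1) else 0

/-- `A = U (Σ; 0) Vᵀ` is a singular value decomposition with simple positive singular values
`σ_1 > σ_2 > ⋯ > σ_n > 0`. -/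
structure IsSimpleSVD {m n : ℕ} (A : Matrix (Fin m) (Fin n) ℝ) (U : Matrix (Fin m) (Fin m) ℝ)
    (σ : ℕ → ℝ) (V : Matrix (Fin n) (Fin n) ℝ) : Prop where
  le : n ≤ m
  orthU : U ∈ Matrix.orthogonalGroup (Fin m) ℝ
  orthV : V ∈ Matrix.orthogonalGroup (Fin n) ℝ
  pos : ∀ j, 1 ≤ j → j ≤ n → 0 < σ j
  anti : ∀ i j, 1 ≤ i → i < j → j ≤ n → σ j < σ i
  eq : A = U * sigmaMatrix m n σ * Vᵀ

/-- A discrete ill-posed problem `A x = b`, `b = bhat + e`, whose noise-free right-hand side `bhat`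
obeys the model discrete Picard condition with exponent `β`, and whose noisy Fourier coefficients
`|u_jᵀ b|` equal the noise-free ones up to the transition index `k₀`, equal the noise level `η`
after it, and are nonincreasing. -/
structure IllPosedProblem (m n : ℕ) where
  A : Matrix (Fin m) (Fin n) ℝ
  U : Matrix (Fin m) (Fin m) ℝ
  V : Matrix (Fin n) (Fin n) ℝ
  /-- `σ j` is the `j`-th singular value for `1 ≤ j ≤ n`; other values are not used. -/
  σ : ℕ → ℝ
  bhat : EuclideanSpace ℝ (Fin m)
  e : EuclideanSpace ℝ (Fin m)
  β : ℝ
  η : ℝ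
  k₀ : ℕ
  svd : IsSimpleSVD A U σ V
  β_pos : 0 < β
  η_pos : 0 < η
  one_le_k₀ : 1 ≤ k₀
  k₀_le : k₀ ≤ n
  picard : ∀ j, 1 ≤ j → j ≤ n → |colInner U bhat j| = σ j ^ (1 + β)
  coeff_signal : ∀ j, 1 ≤ j → j ≤ k₀ → |colInner U (bhat + e) j| = |colInner U bhat j|
  coeff_noise : ∀ j, k₀ < j → j ≤ n → |colInner U (bhat + e) j| = η
  coeff_anti : ∀ j, 1 ≤ j → j + 1 ≤ n →
    |colInner U (bhat + e) (j + 1)| ≤ |colInner U (bhat + e) j|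

namespace IllPosedProblem

variable {m n : ℕ} (P : IllPosedProblem m n)

/-- The noisy right-hand side. -/
def b : EuclideanSpace ℝ (Fin m) := P.bhat + P.e

/-- The Fourier coefficient `u_jᵀ b`. -/
def c (j : ℕ) : ℝ := colInner P.U P.b j

/-- `γ_k`, the error of the rank `k` approximation `P_{k+1} B_k Q_kᵀ` to `A`. -/
def gamma (k : ℕ) : ℝ := lanczosError P.A P.b k

/-- `Σ_k = diag(σ_1, …, σ_k)`. -/
def Sig (k : ℕ) : Matrix (Fin k) (Fin k) ℝ := Matrix.diagonal fun i => P.σ (i + 1)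

/-- `D_1 = diag(σ_i u_iᵀ b)`, `1 ≤ i ≤ k`. -/
def D1 (k : ℕ) : Matrix (Fin k) (Fin k) ℝ :=
  Matrix.diagonal fun i => P.σ (i + 1) * P.c (i + 1)

/-- `D_2 = diag(σ_i u_iᵀ b)`, `k < i ≤ n`. -/
def D2 (k : ℕ) : Matrix (Fin (n - k)) (Fin (n - k)) ℝ :=
  Matrix.diagonal fun i => P.σ (k + i + 1) * P.c (k + i + 1)

/-- Rows `1, …, k` of the Vandermonde matrix with rows `(1, σ_i ^ 2, …, σ_i ^ (2 k - 2))`. -/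
def T1 (k : ℕ) : Matrix (Fin k) (Fin k) ℝ :=
  Matrix.of fun i l => P.σ (i + 1) ^ (2 * (l : ℕ))

/-- Rows `k + 1, …, n` of the same Vandermonde matrix. -/
def T2 (k : ℕ) : Matrix (Fin (n - k)) (Fin k) ℝ :=
  Matrix.of fun i l => P.σ (k + i + 1) ^ (2 * (l : ℕ))

/-- `Δ_k = D_2 T_{k2} T_{k1}⁻¹ D_1⁻¹`, of size `(n - k) × k`. -/
def Delta (k : ℕ) : Matrix (Fin (n - k)) (Fin k) ℝ :=
  P.D2 k * P.T2 k * (P.T1 k)⁻¹ * (P.D1 k)⁻¹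

/-- `ξ_k = (‖Δ_k (I + Δ_kᵀ Δ_k)⁻¹‖² + 1)^{1/2}`. -/
def xi (k : ℕ) : ℝ :=
  Real.sqrt (‖P.Delta k * (1 + (P.Delta k)ᵀ * P.Delta k)⁻¹‖ ^ 2 + 1)

/-- `ε_k`, where
`ε_k² = ‖Σ_k (I + Δ_kᵀ Δ_k)⁻¹ Δ_kᵀ Δ_k‖² + ‖Σ_k (I + Δ_kᵀ Δ_k)⁻¹ Δ_kᵀ‖²`. -/
def eps (k : ℕ) : ℝ :=
  Real.sqrt
    (‖P.Sig k * (1 + (P.Delta k)ᵀ * P.Delta k)⁻¹ * ((P.Delta k)ᵀ * P.Delta k)‖ ^ 2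
      + ‖P.Sig k * (1 + (P.Delta k)ᵀ * P.Delta k)⁻¹ * (P.Delta k)ᵀ‖ ^ 2)

/-- `η_k = ε_k / σ_{k+1}`. -/
def eta (k : ℕ) : ℝ := P.eps k / P.σ (k + 1)

/-- `|L_j^{(k)}(0)| = ∏_{1 ≤ i ≤ k, i ≠ j} σ_i² / |σ_j² - σ_i²|`. -/
def lagrangeAtZero (k j : ℕ) : ℝ :=
  ∏ i ∈ (Finset.Icc 1 k).erase j, P.σ i ^ 2 / |P.σ j ^ 2 - P.σ i ^ 2|

/-- `|L_{k_1}^{(k)}(0)| = max_{1 ≤ j ≤ k} |L_j^{(k)}(0)|`. -/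
def lagrangeMax (k : ℕ) : ℝ := ⨆ j : Fin k, P.lagrangeAtZero k (j + 1)

/-- The singular values are of order `ρ^{-j}`, with constants made explicit: `ρ > 1`,
`σ_{j+d} ≤ κ ρ^{-d} σ_j`, and the relative gaps are controlled by `σ_{j+1} ≤ δ σ_j`.
Since the `σ_j` are finitely many and strictly decreasing, every problem satisfies this for
suitable `κ` and `δ < 1`; these two numbers are what the constant in `𝒪(ρ^{-2})` depends on.
If `c ρ^{-j} ≤ σ_j ≤ κ c ρ^{-j}` for all `j`, the decay inequality holds with this `κ`,
and if moreover `κ < ρ`, the gap inequality holds with `δ = κ / ρ`. -/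
structure IsSevere (ρ κ δ : ℝ) : Prop where
  one_lt : 1 < ρ
  decay : ∀ j d, 1 ≤ j → j + d ≤ n → P.σ (j + d) ≤ κ * (ρ ^ d)⁻¹ * P.σ j
  gap : ∀ j, 1 ≤ j → j + 1 ≤ n → P.σ (j + 1) ≤ δ * P.σ j

/-- The moderately (`α > 1`) or mildly (`1/2 < α ≤ 1`) ill-posed model `σ_j = ζ j^{-α}`. -/
structure IsModerateOrMild (ζ α : ℝ) : Prop where
  ζ_pos : 0 < ζ
  half_lt : 1 / 2 < α
  eq : ∀ j, 1 ≤ j → j ≤ n → P.σ j = ζ * (j : ℝ) ^ (-α)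

end IllPosedProblem

end

/-! The recurrences give `A Q_k = P_{k+1} B_k`, so `γ_k = ‖A (I - Q_k Q_kᵀ)‖` and only the span of
`Q_k` matters. It contains the Krylov vectors `(AᵀA)^l Aᵀb`, `l < k`. In the coordinates of `V`
these are the columns of `(D_1 T_{k1}; D_2 T_{k2})`, whose range is that of `(I; Δ_k)`, because
nonzero Fourier coefficients and distinct singular values make `D_1` and `T_{k1}` invertible. So in
these coordinates `Q_k Q_kᵀ` is `(I; Δ)(I + ΔᵀΔ)⁻¹(I, Δᵀ)`.

The lower bound for `γ_k` is a dimension count. For the upper bound, split `‖A (I - QQᵀ) x‖²` by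
singular direction: directions beyond `k` contribute at most `σ_{k+1}² ‖x‖²`, the first `k` at most
`ε_k² ‖x‖²`.

Push-through identities give `ε_k ≤ ξ_k ‖Δ_k Σ_k‖`. The entries of `T_{k2} T_{k1}⁻¹` are Lagrange
basis polynomials at nodes `σ_j²`, evaluated at smaller points `σ_i²`, hence at most `|L_j(0)|`. The
Frobenius norm then bounds `‖Δ_k Σ_k‖²` by `(c_{k+1}/c_k)²` times the tail `∑_{i>k} σ_i²` times `∑_j
(c_k/c_j)² L_j(0)²` (`eta_le`). For severe decay both sums are controlled by geometric series; for
power decay, by comparison with integrals. -/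

namespace Matrix

/-! ### Euclidean vectors and the matrix 2-norm. -/

section L2Norm

variable {ι κ : Type*} [Fintype ι] [Fintype κ] [DecidableEq κ]

theorem dotProduct_self_eq_norm_toLp_sq {ι : Type*} [Fintype ι] (x : ι → ℝ) :
    x ⬝ᵥ x = ‖WithLp.toLp 2 x‖ ^ 2 := by
  rw [EuclideanSpace.real_norm_sq_eq]
  simp [dotProduct, sq]

theorem dotProduct_self_nonneg_real (x : ι → ℝ) : 0 ≤ x ⬝ᵥ x := by
  rw [dotProduct_self_eq_norm_toLp_sq]; positivity

theorem norm_toLp_mulVec_le (M : Matrix ι κ ℝ) (x : κ → ℝ) :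
    ‖WithLp.toLp 2 (M *ᵥ x)‖ ≤ ‖M‖ * ‖WithLp.toLp 2 x‖ :=
  l2_opNorm_mulVec M (WithLp.toLp 2 x)

theorem dotProduct_mulVec_self_le (M : Matrix ι κ ℝ) (x : κ → ℝ) :
    (M *ᵥ x) ⬝ᵥ (M *ᵥ x) ≤ ‖M‖ ^ 2 * (x ⬝ᵥ x) := by
  rw [dotProduct_self_eq_norm_toLp_sq, dotProduct_self_eq_norm_toLp_sq, ← mul_pow]
  exact pow_le_pow_left₀ (norm_nonneg _) (norm_toLp_mulVec_le M x) 2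

theorem l2_opNorm_le_of_dotProduct_le (M : Matrix ι κ ℝ) {c : ℝ} (hc : 0 ≤ c)
    (h : ∀ x : κ → ℝ, (M *ᵥ x) ⬝ᵥ (M *ᵥ x) ≤ c ^ 2 * (x ⬝ᵥ x)) : ‖M‖ ≤ c := by
  rw [l2_opNorm_def]
  refine ContinuousLinearMap.opNorm_le_bound _ hc fun x => ?_
  have := h x.ofLp
  rw [dotProduct_self_eq_norm_toLp_sq, dotProduct_self_eq_norm_toLp_sq, ← mul_pow] at this
  exact le_of_sq_le_sq this (by positivity)

theorem l2_opNorm_transpose_real [DecidableEq ι] (M : Matrix ι κ ℝ) : ‖Mᵀ‖ = ‖M‖ := by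
  rw [← conjTranspose_eq_transpose_of_trivial, l2_opNorm_conjTranspose]

/-- Cauchy–Schwarz in each row: the Frobenius norm dominates the 2-norm. -/
theorem l2_opNorm_le_sqrt_sum_sq (M : Matrix ι κ ℝ) :
    ‖M‖ ≤ Real.sqrt (∑ i, ∑ j, M i j ^ 2) := by
  refine l2_opNorm_le_of_dotProduct_le M (Real.sqrt_nonneg _) fun x => ?_
  have h0 : 0 ≤ ∑ i, ∑ j, M i j ^ 2 :=
    Finset.sum_nonneg fun i _ => Finset.sum_nonneg fun j _ => sq_nonneg _
  rw [Real.sq_sqrt h0, Finset.sum_mul]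
  simp only [dotProduct]
  refine Finset.sum_le_sum fun i _ => ?_
  rw [← sq]
  have := Finset.sum_mul_sq_le_sq_mul_sq Finset.univ (fun j => M i j) x
  simpa [mulVec, dotProduct, sq] using this

/-- The triangle inequality and `(as + bt)² ≤ (a² + b²)(s² + t²)`; this is the origin of the sum of
two squares in `ε_k`. -/
theorem dotProduct_self_sub_le {a b : ℝ} {X : Matrix ι κ ℝ} {μ : Type*} [Fintype μ]
    [DecidableEq μ] {Y : Matrix ι μ ℝ} (hX : ‖X‖ = a) (hY : ‖Y‖ = b) (x : κ → ℝ) (y : μ → ℝ) :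
    (X *ᵥ x - Y *ᵥ y) ⬝ᵥ (X *ᵥ x - Y *ᵥ y) ≤ (a ^ 2 + b ^ 2) * (x ⬝ᵥ x + y ⬝ᵥ y) := by
  have h1 := norm_toLp_mulVec_le X x
  have h2 := norm_toLp_mulVec_le Y y
  have h3 : ‖WithLp.toLp 2 (X *ᵥ x - Y *ᵥ y)‖
      ≤ a * ‖WithLp.toLp 2 x‖ + b * ‖WithLp.toLp 2 y‖ := by
    subst hX hY
    exact (norm_sub_le (WithLp.toLp 2 (X *ᵥ x)) (WithLp.toLp 2 (Y *ᵥ y))).trans (add_le_add h1 h2)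
  simp only [dotProduct_self_eq_norm_toLp_sq]
  refine (pow_le_pow_left₀ (norm_nonneg _) h3 2).trans ?_
  nlinarith [sq_nonneg (a * ‖WithLp.toLp 2 y‖ - b * ‖WithLp.toLp 2 x‖)]

end L2Norm

/-! ### The matrix `(1 + DᵀD)⁻¹` and the projector onto the range of `(1; D)`. -/

section Gram

variable {ι κ : Type*} [Fintype ι] [Fintype κ] [DecidableEq κ]

theorem isUnit_det_one_add_transpose_mul_self (D : Matrix ι κ ℝ) : IsUnit (1 + Dᵀ * D).det := by
  have h : (1 + Dᵀ * D).PosDef := by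
    rw [← conjTranspose_eq_transpose_of_trivial]
    exact PosDef.one.add_posSemidef (posSemidef_conjTranspose_mul_self D)
  exact (isUnit_iff_isUnit_det _).1 h.isUnit

/-- The vector `y = (1 + DᵀD)⁻¹ x` satisfies `⟨x, y⟩ = ‖y‖² + ‖D y‖²`. -/
theorem dotProduct_inv_one_add_gram (D : Matrix ι κ ℝ) (x : κ → ℝ) :
    x ⬝ᵥ ((1 + Dᵀ * D)⁻¹ *ᵥ x) = ((1 + Dᵀ * D)⁻¹ *ᵥ x) ⬝ᵥ ((1 + Dᵀ * D)⁻¹ *ᵥ x)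
      + (D *ᵥ ((1 + Dᵀ * D)⁻¹ *ᵥ x)) ⬝ᵥ (D *ᵥ ((1 + Dᵀ * D)⁻¹ *ᵥ x)) := by
  obtain ⟨y, hy⟩ : ∃ y, y = (1 + Dᵀ * D)⁻¹ *ᵥ x := ⟨_, rfl⟩
  rw [← hy]
  have hx : x = y + Dᵀ *ᵥ (D *ᵥ y) := by
    calc x = (1 + Dᵀ * D) *ᵥ y := by
          rw [hy, mulVec_mulVec, mul_nonsing_inv _ (isUnit_det_one_add_transpose_mul_self D),
            one_mulVec]
      _ = y + Dᵀ *ᵥ (D *ᵥ y) := by rw [add_mulVec, one_mulVec, ← mulVec_mulVec]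
  calc x ⬝ᵥ y = (y + Dᵀ *ᵥ (D *ᵥ y)) ⬝ᵥ y := by rw [← hx]
    _ = _ := by
      rw [add_dotProduct, dotProduct_comm (Dᵀ *ᵥ _), dotProduct_mulVec y, vecMul_transpose]

/-- Cauchy–Schwarz on the preceding identity. With `s = ‖x‖`, `y = ‖(1 + DᵀD)⁻¹x‖` and `z = ‖D(1 +
DᵀD)⁻¹x‖` it reads `y² + z² ≤ s y`, from which the next three norm bounds follow by scalar algebra.
-/
theorem norm_add_gram_le (D : Matrix ι κ ℝ) (x : κ → ℝ) :
    ‖WithLp.toLp 2 ((1 + Dᵀ * D)⁻¹ *ᵥ x)‖ ^ 2 + ‖WithLp.toLp 2 (D *ᵥ ((1 + Dᵀ * D)⁻¹ *ᵥ x))‖ ^ 2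
      ≤ ‖WithLp.toLp 2 x‖ * ‖WithLp.toLp 2 ((1 + Dᵀ * D)⁻¹ *ᵥ x)‖ := by
  rw [← dotProduct_self_eq_norm_toLp_sq, ← dotProduct_self_eq_norm_toLp_sq,
    ← dotProduct_inv_one_add_gram]
  have := real_inner_le_norm (WithLp.toLp 2 x) (WithLp.toLp 2 ((1 + Dᵀ * D)⁻¹ *ᵥ x))
  rwa [EuclideanSpace.inner_eq_star_dotProduct, star_trivial, dotProduct_comm] at this

theorem norm_inv_one_add_gram_le_one (D : Matrix ι κ ℝ) : ‖(1 + Dᵀ * D)⁻¹‖ ≤ 1 := by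
  refine l2_opNorm_le_of_dotProduct_le _ zero_le_one fun x => ?_
  have h := norm_add_gram_le D x
  rw [dotProduct_self_eq_norm_toLp_sq, dotProduct_self_eq_norm_toLp_sq, one_pow, one_mul]
  refine pow_le_pow_left₀ (norm_nonneg _) ?_ 2
  set s := ‖WithLp.toLp 2 x‖
  set t := ‖WithLp.toLp 2 ((1 + Dᵀ * D)⁻¹ *ᵥ x)‖
  have hs : 0 ≤ s := norm_nonneg _
  have ht : 0 ≤ t := norm_nonneg _
  by_contra! hlt
  nlinarith [sq_nonneg ‖WithLp.toLp 2 (D *ᵥ ((1 + Dᵀ * D)⁻¹ *ᵥ x))‖]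

/-- `z² ≤ y (s - y) ≤ s²/4`. -/
theorem norm_mul_inv_one_add_gram_le_half (D : Matrix ι κ ℝ) : ‖D * (1 + Dᵀ * D)⁻¹‖ ≤ 1 / 2 := by
  refine l2_opNorm_le_of_dotProduct_le _ (by norm_num) fun x => ?_
  have h := norm_add_gram_le D x
  rw [← mulVec_mulVec, dotProduct_self_eq_norm_toLp_sq, dotProduct_self_eq_norm_toLp_sq]
  nlinarith [sq_nonneg (‖WithLp.toLp 2 x‖ - 2 * ‖WithLp.toLp 2 ((1 + Dᵀ * D)⁻¹ *ᵥ x)‖)]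

theorem norm_mul_inv_one_add_gram_le (D : Matrix ι κ ℝ) (hD : ‖D‖ < 1) :
    ‖D * (1 + Dᵀ * D)⁻¹‖ ≤ ‖D‖ / (1 + ‖D‖ ^ 2) := by
  refine l2_opNorm_le_of_dotProduct_le _ (by positivity) fun x => ?_
  have h := norm_add_gram_le D x
  have h2 := norm_toLp_mulVec_le D ((1 + Dᵀ * D)⁻¹ *ᵥ x)
  rw [← mulVec_mulVec, dotProduct_self_eq_norm_toLp_sq, dotProduct_self_eq_norm_toLp_sq, ← mul_pow]
  refine pow_le_pow_left₀ (norm_nonneg _) ?_ 2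
  have hx : 0 ≤ ‖WithLp.toLp 2 x‖ := norm_nonneg _
  have hy : 0 ≤ ‖WithLp.toLp 2 ((1 + Dᵀ * D)⁻¹ *ᵥ x)‖ := norm_nonneg _
  have hz : 0 ≤ ‖WithLp.toLp 2 (D *ᵥ ((1 + Dᵀ * D)⁻¹ *ᵥ x))‖ := norm_nonneg _
  have ht : 0 ≤ ‖D‖ := norm_nonneg _
  generalize ‖WithLp.toLp 2 x‖ = s at *
  generalize ‖WithLp.toLp 2 (D *ᵥ ((1 + Dᵀ * D)⁻¹ *ᵥ x))‖ = z at *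
  generalize ‖WithLp.toLp 2 ((1 + Dᵀ * D)⁻¹ *ᵥ x)‖ = y at *
  generalize ‖D‖ = t at *
  rw [div_mul_eq_mul_div, le_div_iff₀ (by positivity)]
  rcases hy.eq_or_lt with rfl | hy
  · nlinarith
  refine le_of_mul_le_mul_right ?_ hy
  -- Expanded, this is `(1 + t²) y z ≤ t (y² + z²)`, and the right side is at most `t s y`. The
  -- second factor is nonnegative because `t z ≤ t² y ≤ y`, which is where `‖D‖ < 1` enters.
  have h3 : 0 ≤ (t * y - z) * (y - t * z) := by
    refine mul_nonneg (by linarith) ?_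
    nlinarith
  nlinarith

/-- For the reverse bound write `D = D G⁻¹ · G` with `G = 1 + DᵀD` and `‖G‖ ≤ 1 + ‖D‖²`. -/
theorem norm_mul_inv_one_add_gram [DecidableEq ι] (D : Matrix ι κ ℝ) (hD : ‖D‖ < 1) :
    ‖D * (1 + Dᵀ * D)⁻¹‖ = ‖D‖ / (1 + ‖D‖ ^ 2) := by
  refine le_antisymm (norm_mul_inv_one_add_gram_le D hD) ?_
  rw [div_le_iff₀ (by positivity)]
  have h1 : ‖1 + Dᵀ * D‖ ≤ 1 + ‖D‖ ^ 2 := by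
    refine (norm_add_le _ _).trans (add_le_add ?_ ?_)
    · exact l2_opNorm_le_of_dotProduct_le _ zero_le_one fun x => by simp
    · refine (l2_opNorm_mul _ _).trans ?_
      rw [l2_opNorm_transpose_real, sq]
  calc ‖D‖ = ‖D * (1 + Dᵀ * D)⁻¹ * (1 + Dᵀ * D)‖ := by
        rw [Matrix.mul_assoc, nonsing_inv_mul _ (isUnit_det_one_add_transpose_mul_self D),
          Matrix.mul_one]
    _ ≤ ‖D * (1 + Dᵀ * D)⁻¹‖ * ‖1 + Dᵀ * D‖ := l2_opNorm_mul _ _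
    _ ≤ _ := mul_le_mul_of_nonneg_left h1 (norm_nonneg _)

theorem inv_one_add_gram_mul_gram_eq_one_sub (D : Matrix ι κ ℝ) :
    (1 + Dᵀ * D)⁻¹ * (Dᵀ * D) = 1 - (1 + Dᵀ * D)⁻¹ := by
  rw [eq_sub_iff_add_eq]
  calc (1 + Dᵀ * D)⁻¹ * (Dᵀ * D) + (1 + Dᵀ * D)⁻¹ = (1 + Dᵀ * D)⁻¹ * (1 + Dᵀ * D) := by
        rw [Matrix.mul_add, Matrix.mul_one, add_comm]
    _ = 1 := nonsing_inv_mul _ (isUnit_det_one_add_transpose_mul_self D)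

theorem inv_one_add_gram_mul_gram (D : Matrix ι κ ℝ) :
    (1 + Dᵀ * D)⁻¹ * (Dᵀ * D) = Dᵀ * (D * (1 + Dᵀ * D)⁻¹) := by
  have hu := isUnit_det_one_add_transpose_mul_self D
  have h2 : Dᵀ * D * (1 + Dᵀ * D)⁻¹ = 1 - (1 + Dᵀ * D)⁻¹ := by
    rw [eq_sub_iff_add_eq]
    calc Dᵀ * D * (1 + Dᵀ * D)⁻¹ + (1 + Dᵀ * D)⁻¹ = (1 + Dᵀ * D) * (1 + Dᵀ * D)⁻¹ := by
          rw [Matrix.add_mul, Matrix.one_mul, add_comm]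
      _ = 1 := mul_nonsing_inv _ hu
  rw [inv_one_add_gram_mul_gram_eq_one_sub, ← h2, Matrix.mul_assoc]

/-- Push-through: `(1 + DᵀD) Dᵀ = Dᵀ (1 + DDᵀ)`. -/
theorem inv_one_add_gram_mul_transpose [DecidableEq ι] (D : Matrix ι κ ℝ) :
    (1 + Dᵀ * D)⁻¹ * Dᵀ = Dᵀ * (1 + D * Dᵀ)⁻¹ := by
  have hu := isUnit_det_one_add_transpose_mul_self D
  have hu' := isUnit_det_one_add_transpose_mul_self Dᵀ
  rw [transpose_transpose] at hu'
  calc (1 + Dᵀ * D)⁻¹ * Dᵀ = (1 + Dᵀ * D)⁻¹ * (Dᵀ * (1 + D * Dᵀ)) * (1 + D * Dᵀ)⁻¹ := by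
        rw [Matrix.mul_assoc, Matrix.mul_assoc, mul_nonsing_inv _ hu', Matrix.mul_one]
    _ = (1 + Dᵀ * D)⁻¹ * ((1 + Dᵀ * D) * Dᵀ) * (1 + D * Dᵀ)⁻¹ := by
        rw [Matrix.mul_add, Matrix.add_mul, Matrix.mul_one, Matrix.one_mul, Matrix.mul_assoc Dᵀ D]
    _ = _ := by rw [← Matrix.mul_assoc, nonsing_inv_mul _ hu, Matrix.one_mul]

/-- Pushing `Dᵀ` to the left makes `S Dᵀ` a factor of both products. What remains is `D (1 + DᵀD)⁻¹`
in the first and the contraction `(1 + DDᵀ)⁻¹` in the second. -/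
theorem sqrt_norm_sq_add_norm_sq_le [DecidableEq ι] (S : Matrix κ κ ℝ) (D : Matrix ι κ ℝ) :
    Real.sqrt (‖S * (1 + Dᵀ * D)⁻¹ * (Dᵀ * D)‖ ^ 2 + ‖S * (1 + Dᵀ * D)⁻¹ * Dᵀ‖ ^ 2)
      ≤ Real.sqrt (‖D * (1 + Dᵀ * D)⁻¹‖ ^ 2 + 1) * ‖D * Sᵀ‖ := by
  have h0 : ‖D * Sᵀ‖ = ‖S * Dᵀ‖ := by
    rw [← l2_opNorm_transpose_real, transpose_mul, transpose_transpose]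
  have h1 : ‖S * (1 + Dᵀ * D)⁻¹ * (Dᵀ * D)‖ ≤ ‖D * Sᵀ‖ * ‖D * (1 + Dᵀ * D)⁻¹‖ := by
    rw [Matrix.mul_assoc, inv_one_add_gram_mul_gram, ← Matrix.mul_assoc S, h0]
    exact l2_opNorm_mul _ _
  have h2 : ‖S * (1 + Dᵀ * D)⁻¹ * Dᵀ‖ ≤ ‖D * Sᵀ‖ * 1 := by
    rw [Matrix.mul_assoc, inv_one_add_gram_mul_transpose, ← Matrix.mul_assoc S, h0]
    refine (l2_opNorm_mul _ _).trans (mul_le_mul_of_nonneg_left ?_ (norm_nonneg _))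
    simpa using norm_inv_one_add_gram_le_one Dᵀ
  rw [← Real.sqrt_sq (norm_nonneg (D * Sᵀ)), ← Real.sqrt_mul (by positivity)]
  refine Real.sqrt_le_sqrt ?_
  have h3 := pow_le_pow_left₀ (norm_nonneg _) h1 2
  have h4 := pow_le_pow_left₀ (norm_nonneg _) h2 2
  nlinarith

/-- If `Q` has orthonormal columns spanning the range of `(1; D)`, then `QQᵀ` is the orthogonal
projector `(1; D) (1 + DᵀD)⁻¹ (1, Dᵀ)`. -/
theorem mul_transpose_eq_of_mul_eq_fromRows {Q : Matrix (κ ⊕ ι) κ ℝ} {S : Matrix κ κ ℝ}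
    {D : Matrix ι κ ℝ} (hQ : Qᵀ * Q = 1) (hS : Q * S = fromRows 1 D) :
    Q * Qᵀ = fromRows 1 D * (1 + Dᵀ * D)⁻¹ * (fromRows 1 D)ᵀ := by
  -- Both are the Gram matrix of `QS`; in particular `S` is invertible.
  have h1 : Sᵀ * S = 1 + Dᵀ * D := by
    have : (Q * S)ᵀ * (Q * S) = Sᵀ * S := by
      rw [transpose_mul, Matrix.mul_assoc, ← Matrix.mul_assoc Qᵀ, hQ, Matrix.one_mul]
    rw [← this, hS, transpose_fromRows, fromCols_mul_fromRows, transpose_one, Matrix.one_mul]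
  have hu : IsUnit (Sᵀ * S).det := h1 ▸ isUnit_det_one_add_transpose_mul_self D
  rw [det_mul, IsUnit.mul_iff] at hu
  rw [← h1, ← hS, mul_inv_rev, transpose_mul]
  calc Q * Qᵀ = Q * (S * S⁻¹) * (Sᵀ⁻¹ * Sᵀ) * Qᵀ := by
        rw [mul_nonsing_inv _ hu.2, nonsing_inv_mul _ hu.1, Matrix.mul_one, Matrix.mul_one]
    _ = _ := by simp only [Matrix.mul_assoc]

theorem dotProduct_sub_projector_le {μ ν : Type*} [Fintype μ] [Fintype ν] [DecidableEq ν]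
    {Q : Matrix μ ν ℝ} (hQ : Qᵀ * Q = 1) (w : μ → ℝ) :
    (w - Q *ᵥ (Qᵀ *ᵥ w)) ⬝ᵥ (w - Q *ᵥ (Qᵀ *ᵥ w)) ≤ w ⬝ᵥ w := by
  have h1 : (Q *ᵥ (Qᵀ *ᵥ w)) ⬝ᵥ w = (Qᵀ *ᵥ w) ⬝ᵥ (Qᵀ *ᵥ w) := by
    rw [dotProduct_comm, dotProduct_mulVec, ← mulVec_transpose]
  have h2 : (Q *ᵥ (Qᵀ *ᵥ w)) ⬝ᵥ (Q *ᵥ (Qᵀ *ᵥ w)) = (Qᵀ *ᵥ w) ⬝ᵥ (Qᵀ *ᵥ w) := by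
    rw [dotProduct_mulVec, ← mulVec_transpose, mulVec_mulVec, hQ, one_mulVec]
  have h3 := dotProduct_self_nonneg_real (Qᵀ *ᵥ w)
  rw [sub_dotProduct, dotProduct_sub, dotProduct_sub, h1, h2, dotProduct_comm w (Q *ᵥ _), h1]
  linarith

end Gram

end Matrix

/-! ### Lanczos bidiagonalization: recurrences, orthogonality, Krylov spaces. -/

section Lanczos

variable {m n : ℕ} (A : Matrix (Fin m) (Fin n) ℝ) (b : EuclideanSpace ℝ (Fin m))

theorem Matrix.inner_toEuclideanLin_left (x : EuclideanSpace ℝ (Fin n))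
    (y : EuclideanSpace ℝ (Fin m)) :
    inner ℝ (Matrix.toEuclideanLin A x) y = inner ℝ x (Matrix.toEuclideanLin Aᵀ y) := by
  rw [← Matrix.conjTranspose_eq_transpose_of_trivial, Matrix.toEuclideanLin_conjTranspose_eq_adjoint,
    LinearMap.adjoint_inner_right]

/-- Valid also at breakdown: a vanishing remainder makes both sides zero. The recurrences therefore
need no hypothesis on the process. -/
theorem lanczos_alpha_smul_q (j : ℕ) :
    (lanczos A b (j + 1)).alpha • (lanczos A b (j + 1)).q
      = Matrix.toEuclideanLin Aᵀ (lanczos A b j).p - (lanczos A b j).beta • (lanczos A b j).q := by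
  change ‖_‖ • (‖_‖⁻¹ • _) = _
  by_cases h : Matrix.toEuclideanLin Aᵀ (lanczos A b j).p
      - (lanczos A b j).beta • (lanczos A b j).q = 0
  · rw [h]; simp
  · rw [smul_inv_smul₀ (norm_ne_zero_iff.2 h)]

theorem lanczos_beta_smul_p (j : ℕ) :
    (lanczos A b (j + 1)).beta • (lanczos A b (j + 1)).p
      = Matrix.toEuclideanLin A (lanczos A b (j + 1)).q
        - (lanczos A b (j + 1)).alpha • (lanczos A b j).p := by
  change ‖Matrix.toEuclideanLin A (lanczos A b (j + 1)).q
        - (lanczos A b (j + 1)).alpha • (lanczos A b j).p‖ •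
      (‖Matrix.toEuclideanLin A (lanczos A b (j + 1)).q
        - (lanczos A b (j + 1)).alpha • (lanczos A b j).p‖⁻¹ • _) = _
  by_cases h : Matrix.toEuclideanLin A (lanczos A b (j + 1)).q
        - (lanczos A b (j + 1)).alpha • (lanczos A b j).p = 0
  · rw [h]; simp
  · rw [smul_inv_smul₀ (norm_ne_zero_iff.2 h)]
    rfl

theorem transpose_lanczos_p (j : ℕ) :
    Matrix.toEuclideanLin Aᵀ (lanczos A b j).p
      = (lanczos A b j).beta • (lanczos A b j).q
        + (lanczos A b (j + 1)).alpha • (lanczos A b (j + 1)).q := by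
  rw [lanczos_alpha_smul_q]; abel

theorem apply_lanczos_q (j : ℕ) :
    Matrix.toEuclideanLin A (lanczos A b (j + 1)).q
      = (lanczos A b (j + 1)).alpha • (lanczos A b j).p
        + (lanczos A b (j + 1)).beta • (lanczos A b (j + 1)).p := by
  rw [lanczos_beta_smul_p]; abel

theorem inner_normalize_self {E : Type*} [NormedAddCommGroup E] [InnerProductSpace ℝ E] (x : E) :
    x = 0 ∨ inner ℝ (‖x‖⁻¹ • x) (‖x‖⁻¹ • x) = (1 : ℝ) := by
  by_cases h : x = 0
  · exact Or.inl h
  · right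
    rw [real_inner_self_eq_norm_sq, norm_smul, norm_inv, norm_norm,
      inv_mul_cancel₀ (norm_ne_zero_iff.2 h), one_pow]

theorem lanczos_q_normalized (j : ℕ) :
    ((lanczos A b j).q = 0 ∧ (lanczos A b j).alpha = 0)
      ∨ inner ℝ (lanczos A b j).q (lanczos A b j).q = (1 : ℝ) := by
  cases j with
  | zero => exact Or.inl ⟨rfl, rfl⟩
  | succ j =>
    rcases inner_normalize_self (Matrix.toEuclideanLin Aᵀ (lanczos A b j).p
      - (lanczos A b j).beta • (lanczos A b j).q) with h | h
    · refine Or.inl ⟨?_, ?_⟩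
      · change _ • (Matrix.toEuclideanLin Aᵀ (lanczos A b j).p
          - (lanczos A b j).beta • (lanczos A b j).q) = 0
        rw [h, smul_zero]
      · change ‖Matrix.toEuclideanLin Aᵀ (lanczos A b j).p
          - (lanczos A b j).beta • (lanczos A b j).q‖ = 0
        rw [h, norm_zero]
    · exact Or.inr h

theorem lanczos_p_normalized (j : ℕ) :
    ((lanczos A b j).p = 0 ∧ (lanczos A b j).beta = 0)
      ∨ inner ℝ (lanczos A b j).p (lanczos A b j).p = (1 : ℝ) := by
  cases j with
  | zero =>
    rcases inner_normalize_self b with h | h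
    · refine Or.inl ⟨?_, rfl⟩
      change _ • b = 0
      rw [h, smul_zero]
    · exact Or.inr h
  | succ j =>
    rcases inner_normalize_self (Matrix.toEuclideanLin A (lanczos A b (j + 1)).q
        - (lanczos A b (j + 1)).alpha • (lanczos A b j).p) with h | h
    · refine Or.inl ⟨?_, ?_⟩
      · change _ • (Matrix.toEuclideanLin A (lanczos A b (j + 1)).q
          - (lanczos A b (j + 1)).alpha • (lanczos A b j).p) = 0
        rw [h, smul_zero]
      · change ‖Matrix.toEuclideanLin A (lanczos A b (j + 1)).q
          - (lanczos A b (j + 1)).alpha • (lanczos A b j).p‖ = 0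
        rw [h, norm_zero]
    · exact Or.inr h

/-- This and the next three identities replace `‖p‖ = ‖q‖ = 1`. Each squared norm is multiplied by a
coefficient that vanishes whenever the vector does, so orthogonality can be proved before breakdown
is excluded. -/
theorem lanczos_alpha_mul_inner_q (j : ℕ) :
    (lanczos A b j).alpha * inner ℝ (lanczos A b j).q (lanczos A b j).q
      = (lanczos A b j).alpha := by
  rcases lanczos_q_normalized A b j with ⟨_, h⟩ | h <;> simp only [h, zero_mul, mul_one]

theorem lanczos_beta_mul_inner_p (j : ℕ) :
    (lanczos A b j).beta * inner ℝ (lanczos A b j).p (lanczos A b j).p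
      = (lanczos A b j).beta := by
  rcases lanczos_p_normalized A b j with ⟨_, h⟩ | h <;> simp only [h, zero_mul, mul_one]

theorem lanczos_alpha_succ_mul_inner_p (j : ℕ) :
    (lanczos A b (j + 1)).alpha * inner ℝ (lanczos A b j).p (lanczos A b j).p
      = (lanczos A b (j + 1)).alpha := by
  rcases lanczos_p_normalized A b j with ⟨h, h'⟩ | h
  · have : (lanczos A b (j + 1)).alpha = 0 := by
      change ‖Matrix.toEuclideanLin Aᵀ (lanczos A b j).p
          - (lanczos A b j).beta • (lanczos A b j).q‖ = 0
      rw [h, h']; simp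
    rw [this, zero_mul]
  · rw [h, mul_one]

theorem lanczos_beta_mul_inner_q (j : ℕ) :
    (lanczos A b j).beta * inner ℝ (lanczos A b j).q (lanczos A b j).q
      = (lanczos A b j).beta := by
  rcases lanczos_q_normalized A b j with ⟨h, h'⟩ | h
  · have : (lanczos A b j).beta = 0 := by
      cases j with
      | zero => rfl
      | succ j =>
        change ‖Matrix.toEuclideanLin A (lanczos A b (j + 1)).q
          - (lanczos A b (j + 1)).alpha • (lanczos A b j).p‖ = 0
        rw [h, h']; simp
    rw [this, zero_mul]
  · rw [h, mul_one]

theorem lanczos_orthogonal (N : ℕ) :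
    (∀ i < N, inner ℝ (lanczos A b N).p (lanczos A b i).p = (0 : ℝ)) ∧
      ∀ i < N, inner ℝ (lanczos A b N).q (lanczos A b i).q = (0 : ℝ) := by
  induction N using Nat.strong_induction_on with
  | _ N ih =>
  cases N with
  | zero => simp
  | succ N =>
    have hp : ∀ i j, i ≤ N → j ≤ N → i ≠ j →
        inner ℝ (lanczos A b i).p (lanczos A b j).p = (0 : ℝ) := by
      intro i j hi hj hij
      rcases lt_or_gt_of_ne hij with h | h
      · rw [real_inner_comm]; exact (ih j (by omega)).1 i h
      · exact (ih i (by omega)).1 j h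
    have hq : ∀ i j, i ≤ N → j ≤ N → i ≠ j →
        inner ℝ (lanczos A b i).q (lanczos A b j).q = (0 : ℝ) := by
      intro i j hi hj hij
      rcases lt_or_gt_of_ne hij with h | h
      · rw [real_inner_comm]; exact (ih j (by omega)).2 i h
      · exact (ih i (by omega)).2 j h
    have hq' : ∀ i < N + 1, inner ℝ (lanczos A b (N + 1)).q (lanczos A b i).q = (0 : ℝ) := by
      intro i hi
      rcases lanczos_q_normalized A b (N + 1) with ⟨h, _⟩ | h
      · rw [h, inner_zero_left]
      cases i with
      | zero =>
        change inner ℝ _ (0 : EuclideanSpace ℝ (Fin n)) = (0 : ℝ)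
        rw [inner_zero_right]
      | succ i =>
        -- Move `Aᵀ` across the inner product and expand `A q_{i+1}`. For `i + 1 = N` two `β` terms
        -- cancel; otherwise every term vanishes by induction.
        have key : (lanczos A b (N + 1)).alpha
            * inner ℝ (lanczos A b (N + 1)).q (lanczos A b (i + 1)).q = 0 := by
          rw [← real_inner_smul_left, lanczos_alpha_smul_q, inner_sub_left,
            ← real_inner_comm, ← Matrix.inner_toEuclideanLin_left, apply_lanczos_q, inner_add_left,
            real_inner_smul_left, real_inner_smul_left, real_inner_smul_left,
            hp i N (by omega) le_rfl (by omega)]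
          by_cases hiN : i + 1 = N
          · rw [hiN, lanczos_beta_mul_inner_p, lanczos_beta_mul_inner_q]; ring
          · rw [hp (i + 1) N (by omega) le_rfl hiN, hq N (i + 1) le_rfl (by omega) (Ne.symm hiN)]
            ring
        -- If `α = 0`, the new vector is itself zero, hence still orthogonal to the others.
        rcases mul_eq_zero.1 key with h0 | h0
        · have := lanczos_alpha_smul_q A b N
          have hr : Matrix.toEuclideanLin Aᵀ (lanczos A b N).p
              - (lanczos A b N).beta • (lanczos A b N).q = 0 := by rw [← this, h0, zero_smul]
          have hz : (lanczos A b (N + 1)).q = 0 := by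
            change _ • (Matrix.toEuclideanLin Aᵀ (lanczos A b N).p
              - (lanczos A b N).beta • (lanczos A b N).q) = 0
            rw [hr, smul_zero]
          rw [hz, inner_zero_left]
        · exact h0
    refine ⟨fun i hi => ?_, hq'⟩
    have key : (lanczos A b (N + 1)).beta
        * inner ℝ (lanczos A b (N + 1)).p (lanczos A b i).p = 0 := by
      rw [← real_inner_smul_left, lanczos_beta_smul_p, inner_sub_left,
        Matrix.inner_toEuclideanLin_left, transpose_lanczos_p, inner_add_right,
        real_inner_smul_right, real_inner_smul_right, real_inner_smul_left, hq' i hi]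
      by_cases hiN : i = N
      · rw [hiN, lanczos_alpha_mul_inner_q, lanczos_alpha_succ_mul_inner_p]; ring
      · rw [hp N i le_rfl (by omega) (Ne.symm hiN), hq' (i + 1) (by omega)]
        ring
    rcases mul_eq_zero.1 key with h0 | h0
    · have hr : Matrix.toEuclideanLin A (lanczos A b (N + 1)).q
          - (lanczos A b (N + 1)).alpha • (lanczos A b N).p = 0 := by
        rw [← lanczos_beta_smul_p, h0, zero_smul]
      have hz : (lanczos A b (N + 1)).p = 0 := by
        change _ • (Matrix.toEuclideanLin A (lanczos A b (N + 1)).q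
          - (lanczos A b (N + 1)).alpha • (lanczos A b N).p) = 0
        rw [hr, smul_zero]
      rw [hz, inner_zero_left]
    · exact h0

theorem lanczos_q_orthogonal {i j : ℕ} (hij : i ≠ j) :
    inner ℝ (lanczos A b i).q (lanczos A b j).q = (0 : ℝ) := by
  rcases lt_or_gt_of_ne hij with h | h
  · rw [real_inner_comm]; exact (lanczos_orthogonal A b j).2 i h
  · exact (lanczos_orthogonal A b i).2 j h

theorem mul_lanczosQ (k : ℕ) : A * lanczosQ A b k = lanczosP A b k * lanczosB A b k := by
  ext i j
  have h := congrArg (fun v : EuclideanSpace ℝ (Fin m) => v i) (apply_lanczos_q A b j)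
  simp only [PiLp.add_apply, PiLp.smul_apply, smul_eq_mul] at h
  rw [Matrix.mul_apply, Matrix.mul_apply]
  have h1 : ∑ x, A i x * lanczosQ A b k x j
      = (Matrix.toEuclideanLin A (lanczos A b (j + 1)).q) i := rfl
  rw [h1, h, Finset.sum_eq_add (a := (⟨j, by omega⟩ : Fin (k + 1))) (b := ⟨j + 1, by omega⟩)]
  · simp [lanczosP, lanczosB]
    ring
  · simp
  · intro c _ hc
    have h2 : (c : ℕ) ≠ j := fun h => hc.1 (Fin.ext h)
    have h3 : (c : ℕ) ≠ j + 1 := fun h => hc.2 (Fin.ext h)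
    simp [lanczosB, h2, h3]
  · simp
  · simp

/-- Since `P B Qᵀ = A Q Qᵀ`, the error depends on `Q` alone. -/
theorem lanczosError_eq (k : ℕ) :
    lanczosError A b k = ‖A * (1 - lanczosQ A b k * (lanczosQ A b k)ᵀ)‖ := by
  rw [lanczosError, ← mul_lanczosQ, Matrix.mul_sub, Matrix.mul_one, Matrix.mul_assoc]

theorem transpose_mul_lanczosQ (k : ℕ) (h : ∀ j : Fin k, (lanczos A b (j + 1)).q ≠ 0) :
    (lanczosQ A b k)ᵀ * lanczosQ A b k = 1 := by
  ext i j
  have h1 : ((lanczosQ A b k)ᵀ * lanczosQ A b k) i j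
      = inner ℝ (lanczos A b (i + 1)).q (lanczos A b (j + 1)).q := by
    rw [EuclideanSpace.inner_eq_star_dotProduct, star_trivial, dotProduct_comm]
    rfl
  rw [h1]
  by_cases hij : i = j
  · subst hij
    rw [Matrix.one_apply_eq]
    exact (lanczos_q_normalized A b _).resolve_left fun h' => h i h'.1
  · rw [Matrix.one_apply_ne hij]
    exact lanczos_q_orthogonal A b fun h => hij (Fin.ext (by omega))

theorem transpose_apply_mem_span_lanczos_q :
    Matrix.toEuclideanLin Aᵀ b ∈ Submodule.span ℝ {(lanczos A b 1).q} := by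
  have h1 : b = ‖b‖ • (lanczos A b 0).p := by
    change b = ‖b‖ • (‖b‖⁻¹ • b)
    by_cases h : b = 0
    · simp [h]
    · rw [smul_inv_smul₀ (norm_ne_zero_iff.2 h)]
  rw [h1, map_smul, transpose_lanczos_p]
  refine Submodule.smul_mem _ _ (Submodule.add_mem _ (Submodule.smul_mem _ _ ?_)
    (Submodule.smul_mem _ _ ?_))
  · exact Submodule.zero_mem _
  · rw [← h1]; exact Submodule.mem_span_singleton_self _

/-- By the two recurrences, `AᵀA q_j` is a combination of `q_{j-1}`, `q_j`, `q_{j+1}`. -/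
theorem krylov_mem_span_lanczos_q {w : ℕ → EuclideanSpace ℝ (Fin n)}
    (h0 : w 0 = Matrix.toEuclideanLin Aᵀ b)
    (hs : ∀ l, w (l + 1) = Matrix.toEuclideanLin Aᵀ (Matrix.toEuclideanLin A (w l)))
    {k l : ℕ} (hl : l < k) :
    w l ∈ Submodule.span ℝ (Set.range fun j : Fin k => (lanczos A b (j + 1)).q) := by
  have hq : ∀ {K i : ℕ}, i ≤ K → (lanczos A b i).q
      ∈ Submodule.span ℝ (Set.range fun j : Fin K => (lanczos A b (j + 1)).q) := by
    intro K i hi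
    cases i with
    | zero => exact Submodule.zero_mem _
    | succ i => exact Submodule.subset_span ⟨⟨i, by omega⟩, rfl⟩
  have hmono : ∀ {K K' : ℕ}, K ≤ K' →
      Submodule.span ℝ (Set.range fun j : Fin K => (lanczos A b (j + 1)).q)
        ≤ Submodule.span ℝ (Set.range fun j : Fin K' => (lanczos A b (j + 1)).q) := by
    intro K K' hK
    rw [Submodule.span_le]
    rintro _ ⟨j, rfl⟩
    exact hq (by omega)
  -- The induction needs the sharp count: `w l` uses only the first `l + 1` vectors, and each step
  -- adds one.
  refine hmono (K := l + 1) hl ?_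
  clear hl
  induction l with
  | zero =>
    rw [h0]
    have := transpose_apply_mem_span_lanczos_q A b
    obtain ⟨c, hc⟩ := Submodule.mem_span_singleton.1 this
    rw [← hc]
    exact Submodule.smul_mem _ _ (hq (by omega))
  | succ l ih =>
    rw [hs]
    refine Submodule.span_induction (p := fun x _ =>
      Matrix.toEuclideanLin Aᵀ (Matrix.toEuclideanLin A x) ∈ Submodule.span ℝ
        (Set.range fun j : Fin (l + 1 + 1) => (lanczos A b (j + 1)).q)) ?_ ?_ ?_ ?_ ih
    · rintro _ ⟨j, rfl⟩
      simp only [apply_lanczos_q, map_add, map_smul, transpose_lanczos_p]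
      exact Submodule.add_mem _
        (Submodule.smul_mem _ _ (Submodule.add_mem _ (Submodule.smul_mem _ _ (hq (by omega)))
          (Submodule.smul_mem _ _ (hq (by omega)))))
        (Submodule.smul_mem _ _ (Submodule.add_mem _ (Submodule.smul_mem _ _ (hq (by omega)))
          (Submodule.smul_mem _ _ (hq (by omega)))))
    · rw [map_zero, map_zero]; exact Submodule.zero_mem _
    · intro x y _ _ hx hy
      rw [map_add, map_add]; exact Submodule.add_mem _ hx hy
    · intro c x _ hx
      rw [map_smul, map_smul]; exact Submodule.smul_mem _ _ hx

end Lanczos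

/-! ### The upper block of the complementary projector. -/

namespace Matrix

variable {ι κ : Type*} [Fintype ι] [Fintype κ] [DecidableEq κ]

theorem sub_projector_comp_inl {Q : Matrix (κ ⊕ ι) κ ℝ} {S : Matrix κ κ ℝ} {D : Matrix ι κ ℝ}
    (hQ : Qᵀ * Q = 1) (hS : Q * S = fromRows 1 D) (w : κ ⊕ ι → ℝ) :
    (w - Q *ᵥ (Qᵀ *ᵥ w)) ∘ Sum.inl = ((1 + Dᵀ * D)⁻¹ * (Dᵀ * D)) *ᵥ (w ∘ Sum.inl)
      - ((1 + Dᵀ * D)⁻¹ * Dᵀ) *ᵥ (w ∘ Sum.inr) := by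
  have h2 : Q *ᵥ (Qᵀ *ᵥ w) = Sum.elim
      ((1 + Dᵀ * D)⁻¹ *ᵥ (w ∘ Sum.inl + Dᵀ *ᵥ (w ∘ Sum.inr)))
      (D *ᵥ ((1 + Dᵀ * D)⁻¹ *ᵥ (w ∘ Sum.inl + Dᵀ *ᵥ (w ∘ Sum.inr)))) := by
    rw [mulVec_mulVec, mul_transpose_eq_of_mul_eq_fromRows hQ hS, ← mulVec_mulVec, ← mulVec_mulVec,
      transpose_fromRows, fromCols_mulVec, fromRows_mulVec, transpose_one, one_mulVec, one_mulVec]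
  rw [inv_one_add_gram_mul_gram_eq_one_sub, h2]
  ext i
  simp only [Function.comp_apply, Pi.sub_apply, Sum.elim_inl, sub_mulVec, one_mulVec, mulVec_add,
    ← mulVec_mulVec, Pi.add_apply]
  ring

theorem dotProduct_orthogonal_mulVec [DecidableEq ι] {U : Matrix ι ι ℝ} (hU : U ∈ orthogonalGroup ι ℝ)
    (z : ι → ℝ) : (U *ᵥ z) ⬝ᵥ (U *ᵥ z) = z ⬝ᵥ z := by
  have h : Uᵀ * U = 1 := (mem_orthogonalGroup_iff' ι ℝ).1 hU
  rw [dotProduct_mulVec, ← mulVec_transpose, mulVec_mulVec, h, one_mulVec]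

end Matrix

/-! ### Consequences of the singular value decomposition. -/

namespace IsSimpleSVD

variable {m n : ℕ} {A : Matrix (Fin m) (Fin n) ℝ} {U : Matrix (Fin m) (Fin m) ℝ} {σ : ℕ → ℝ}
  {V : Matrix (Fin n) (Fin n) ℝ}

theorem transpose_mul_U (h : IsSimpleSVD A U σ V) : Uᵀ * U = 1 :=
  (Matrix.mem_orthogonalGroup_iff' _ ℝ).1 h.orthU

theorem transpose_mul_V (h : IsSimpleSVD A U σ V) : Vᵀ * V = 1 :=
  (Matrix.mem_orthogonalGroup_iff' _ ℝ).1 h.orthV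

theorem mul_transpose_V (h : IsSimpleSVD A U σ V) : V * Vᵀ = 1 :=
  (Matrix.mem_orthogonalGroup_iff _ ℝ).1 h.orthV

theorem sigmaMatrix_gram (h : IsSimpleSVD A U σ V) :
    (sigmaMatrix m n σ)ᵀ * sigmaMatrix m n σ
      = Matrix.diagonal fun i : Fin n => σ (i + 1) ^ 2 := by
  ext i j
  rw [Matrix.mul_apply, Finset.sum_eq_single (⟨i, i.2.trans_le h.le⟩ : Fin m)]
  · by_cases hij : i = j
    · subst hij; simp [sigmaMatrix, sq]
    · have : (i : ℕ) ≠ j := fun h => hij (Fin.ext h)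
      simp [sigmaMatrix, this, hij]
  · intro l _ hl
    have : (l : ℕ) ≠ i := fun h => hl (Fin.ext h)
    simp [sigmaMatrix, this]
  · simp

theorem gram (h : IsSimpleSVD A U σ V) :
    Aᵀ * A = V * (Matrix.diagonal fun i : Fin n => σ (i + 1) ^ 2) * Vᵀ := by
  rw [← h.sigmaMatrix_gram, h.eq]
  simp only [Matrix.transpose_mul, Matrix.transpose_transpose, Matrix.mul_assoc]
  rw [← Matrix.mul_assoc Uᵀ U, h.transpose_mul_U, Matrix.one_mul]

theorem dotProduct_mulVec_self (h : IsSimpleSVD A U σ V) (y : Fin n → ℝ) :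
    (A *ᵥ y) ⬝ᵥ (A *ᵥ y) = ∑ i : Fin n, σ (i + 1) ^ 2 * ((Vᵀ *ᵥ y) i) ^ 2 := by
  have h1 : (A *ᵥ y) ⬝ᵥ (A *ᵥ y) = y ⬝ᵥ ((Aᵀ * A) *ᵥ y) := by
    rw [← Matrix.mulVec_mulVec, Matrix.dotProduct_mulVec y, Matrix.vecMul_transpose]
  rw [h1, h.gram, Matrix.mul_assoc, ← Matrix.mulVec_mulVec, ← Matrix.mulVec_mulVec,
    Matrix.dotProduct_mulVec, ← Matrix.mulVec_transpose]
  simp only [dotProduct, Matrix.mulVec_diagonal]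
  exact Finset.sum_congr rfl fun i _ => by ring

theorem transpose_mulVec (h : IsSimpleSVD A U σ V) (b : EuclideanSpace ℝ (Fin m)) :
    Aᵀ *ᵥ b.ofLp = V *ᵥ fun i : Fin n => σ (i + 1) * colInner U b (i + 1) := by
  rw [h.eq]
  simp only [Matrix.transpose_mul, Matrix.transpose_transpose, ← Matrix.mulVec_mulVec]
  congr 1
  ext i
  have hi : (i : ℕ) < m := i.2.trans_le h.le
  rw [Matrix.mulVec, dotProduct, Finset.sum_eq_single (⟨i, hi⟩ : Fin m)]
  · simp [sigmaMatrix, colInner, hi, Matrix.mulVec, dotProduct]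
  · intro l _ hl
    have : (l : ℕ) ≠ i := fun h => hl (Fin.ext h)
    simp [sigmaMatrix, this]
  · simp

end IsSimpleSVD

/-- The splitting of the indices below `n` into those below `k` and the rest. -/
def finSplit {k n : ℕ} (h : k ≤ n) : Fin k ⊕ Fin (n - k) ≃ Fin n :=
  finSumFinEquiv.trans (finCongr (by omega))

@[simp]
theorem finSplit_inl {k n : ℕ} (h : k ≤ n) (i : Fin k) :
    (finSplit h (Sum.inl i) : ℕ) = i := by
  simp [finSplit]

@[simp]
theorem finSplit_inr {k n : ℕ} (h : k ≤ n) (i : Fin (n - k)) :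
    (finSplit h (Sum.inr i) : ℕ) = k + i := by
  simp [finSplit]

/-! ### The Krylov space in singular coordinates and the bounds for `γ_k`. -/

namespace IllPosedProblem

variable {m n : ℕ} (P : IllPosedProblem m n)

theorem c_ne_zero {j : ℕ} (h1 : 1 ≤ j) (hn : j ≤ n) : P.c j ≠ 0 := by
  rw [← abs_pos]
  by_cases hj : j ≤ P.k₀
  · have h := (P.coeff_signal j h1 hj).trans (P.picard j h1 hn)
    change 0 < |colInner P.U (P.bhat + P.e) j|
    rw [h]
    exact Real.rpow_pos_of_pos (P.svd.pos j h1 hn) _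
  · have h := P.coeff_noise j (by omega) hn
    change 0 < |colInner P.U (P.bhat + P.e) j|
    rw [h]
    exact P.η_pos

theorem abs_c_anti {i j : ℕ} (h1 : 1 ≤ i) (hij : i ≤ j) (hn : j ≤ n) : |P.c j| ≤ |P.c i| := by
  induction j, hij using Nat.le_induction with
  | base => exact le_rfl
  | succ j hij ih => exact (P.coeff_anti j (by omega) hn).trans (ih (by omega))

theorem σ_anti {i j : ℕ} (h1 : 1 ≤ i) (hij : i ≤ j) (hn : j ≤ n) : P.σ j ≤ P.σ i := by
  rcases hij.eq_or_lt with rfl | h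
  · exact le_rfl
  · exact (P.svd.anti i j h1 h hn).le

/-- The Krylov vector `(AᵀA)^l Aᵀb`. -/
noncomputable def krylov (l : ℕ) : EuclideanSpace ℝ (Fin n) :=
  WithLp.toLp 2 (P.V *ᵥ fun i : Fin n => P.σ (i + 1) * P.c (i + 1) * P.σ (i + 1) ^ (2 * l))

theorem krylov_zero : P.krylov 0 = Matrix.toEuclideanLin P.Aᵀ P.b := by
  change _ = WithLp.toLp 2 (P.Aᵀ *ᵥ P.b.ofLp)
  rw [P.svd.transpose_mulVec, krylov]
  simp only [mul_zero, pow_zero, mul_one]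
  rfl

theorem krylov_succ (l : ℕ) :
    P.krylov (l + 1)
      = Matrix.toEuclideanLin P.Aᵀ (Matrix.toEuclideanLin P.A (P.krylov l)) := by
  change _ = WithLp.toLp 2 (P.Aᵀ *ᵥ (P.A *ᵥ (P.krylov l).ofLp))
  rw [Matrix.mulVec_mulVec, P.svd.gram]
  simp only [krylov, Matrix.mulVec_mulVec]
  rw [Matrix.mul_assoc, P.svd.transpose_mul_V, Matrix.mul_one, ← Matrix.mulVec_mulVec]
  congr 2
  ext i
  rw [Matrix.mulVec_diagonal]
  ring

theorem isUnit_det_D1 {k : ℕ} (hk : k ≤ n) : IsUnit (P.D1 k).det := by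
  rw [D1, Matrix.det_diagonal, isUnit_iff_ne_zero, Finset.prod_ne_zero_iff]
  exact fun i _ => mul_ne_zero (P.svd.pos _ (by omega) (by omega)).ne'
    (P.c_ne_zero (by omega) (by omega))

theorem sq_σ_injective {k : ℕ} (hk : k ≤ n) :
    Function.Injective fun i : Fin k => P.σ (i + 1) ^ 2 := by
  intro i j hij
  have hi := P.svd.pos (i + 1) (by omega) (by omega)
  have hj := P.svd.pos (j + 1) (by omega) (by omega)
  have h : P.σ (i + 1) = P.σ (j + 1) := (pow_left_inj₀ hi.le hj.le two_ne_zero).1 hij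
  rcases lt_trichotomy (i : ℕ) j with hlt | heq | hlt
  · exact absurd h (P.svd.anti (i + 1) (j + 1) (by omega) (by omega) (by omega)).ne'
  · exact Fin.ext heq
  · exact absurd h (P.svd.anti (j + 1) (i + 1) (by omega) (by omega) (by omega)).ne

theorem isUnit_det_T1 {k : ℕ} (hk : k ≤ n) : IsUnit (P.T1 k).det := by
  have : P.T1 k = Matrix.vandermonde fun i : Fin k => P.σ (i + 1) ^ 2 := by
    ext i l
    simp [T1, Matrix.vandermonde_apply, pow_mul]
  rw [this, isUnit_iff_ne_zero, Matrix.det_vandermonde_ne_zero_iff]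
  exact P.sq_σ_injective hk

/-- The matrix `VᵀQ_k`, its rows split after the first `k`. -/
noncomputable def rotQ {k : ℕ} (hk : k ≤ n) : Matrix (Fin k ⊕ Fin (n - k)) (Fin k) ℝ :=
  (P.Vᵀ * lanczosQ P.A P.b k).submatrix (finSplit hk) id

theorem exists_rotQ_mul_eq {k : ℕ} (hk : k ≤ n) :
    ∃ R : Matrix (Fin k) (Fin k) ℝ,
      P.rotQ hk * R = Matrix.fromRows (P.D1 k * P.T1 k) (P.D2 k * P.T2 k) := by
  -- The columns of `R` are the coordinates of the Krylov vectors in the Lanczos vectors.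
  have h : ∀ l : Fin k, ∃ r : Fin k → ℝ,
      ∑ j, r j • (lanczos P.A P.b (j + 1)).q = P.krylov l := fun l =>
    (Submodule.mem_span_range_iff_exists_fun ℝ).1
      (krylov_mem_span_lanczos_q P.A P.b P.krylov_zero P.krylov_succ l.2)
  choose r hr using h
  refine ⟨Matrix.of fun j l => r l j, ?_⟩
  have key : (P.Vᵀ * lanczosQ P.A P.b k) * (Matrix.of fun j l => r l j)
      = Matrix.of fun (i : Fin n) (l : Fin k) =>
        P.σ (i + 1) * P.c (i + 1) * P.σ (i + 1) ^ (2 * (l : ℕ)) := by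
    ext i l
    have h1 : lanczosQ P.A P.b k *ᵥ (r l) = (P.krylov l).ofLp := by
      rw [← hr l]
      ext i
      simp [Matrix.mulVec, dotProduct, lanczosQ, mul_comm]
    have h2 : P.Vᵀ *ᵥ (lanczosQ P.A P.b k *ᵥ (r l)) = fun i : Fin n =>
        P.σ (i + 1) * P.c (i + 1) * P.σ (i + 1) ^ (2 * (l : ℕ)) := by
      rw [h1, krylov, Matrix.mulVec_mulVec, P.svd.transpose_mul_V, Matrix.one_mulVec]
    rw [Matrix.mulVec_mulVec] at h2
    exact congrFun h2 i
  have h3 : P.rotQ hk * (Matrix.of fun j l => r l j)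
      = ((P.Vᵀ * lanczosQ P.A P.b k) * (Matrix.of fun j l => r l j)).submatrix
        (finSplit hk) id := rfl
  rw [h3, key]
  ext i l
  rcases i with i | i
  · simp [D1, T1]
  · simp [D2, T2]

/-- No breakdown occurs: a zero `q_{j+1}` would give the upper block of `VᵀQ` a zero column, yet its
product with `R` is the invertible `D_1 T_{k1}`. -/
theorem lanczos_q_ne_zero {k : ℕ} (hk : k ≤ n) (j : Fin k) :
    (lanczos P.A P.b (j + 1)).q ≠ 0 := by
  intro h0
  obtain ⟨R, hR⟩ := P.exists_rotQ_mul_eq hk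
  have h1 : ((P.rotQ hk).submatrix Sum.inl id) * R = P.D1 k * P.T1 k := by
    have := congrArg (fun M => M.submatrix Sum.inl id) hR
    exact this
  have h2 : ((P.rotQ hk).submatrix Sum.inl id).det = 0 := by
    refine Matrix.det_eq_zero_of_column_eq_zero j fun i => ?_
    simp [rotQ, Matrix.mul_apply, lanczosQ, h0]
  have h3 := congrArg Matrix.det h1
  rw [Matrix.det_mul, Matrix.det_mul, h2, zero_mul] at h3
  exact mul_ne_zero (P.isUnit_det_D1 hk).ne_zero (P.isUnit_det_T1 hk).ne_zero h3.symm

theorem transpose_mul_Q {k : ℕ} (hk : k ≤ n) :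
    (lanczosQ P.A P.b k)ᵀ * lanczosQ P.A P.b k = 1 :=
  transpose_mul_lanczosQ P.A P.b k (P.lanczos_q_ne_zero hk)

theorem transpose_mul_rotQ {k : ℕ} (hk : k ≤ n) : (P.rotQ hk)ᵀ * P.rotQ hk = 1 := by
  rw [rotQ, Matrix.transpose_submatrix, Matrix.submatrix_mul_equiv, Matrix.transpose_mul,
    Matrix.transpose_transpose, Matrix.mul_assoc, ← Matrix.mul_assoc P.V, P.svd.mul_transpose_V,
    Matrix.one_mul, P.transpose_mul_Q hk, Matrix.submatrix_id_id]

theorem exists_rotQ_mul_eq_fromRows {k : ℕ} (hk : k ≤ n) :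
    ∃ S : Matrix (Fin k) (Fin k) ℝ, P.rotQ hk * S = Matrix.fromRows 1 (P.Delta k) := by
  obtain ⟨R, hR⟩ := P.exists_rotQ_mul_eq hk
  refine ⟨R * ((P.T1 k)⁻¹ * (P.D1 k)⁻¹), ?_⟩
  rw [← Matrix.mul_assoc, hR, Matrix.fromRows_mul, Delta]
  congr 1
  · rw [Matrix.mul_assoc, ← Matrix.mul_assoc (P.T1 k), Matrix.mul_nonsing_inv _ (P.isUnit_det_T1 hk),
      Matrix.one_mul, Matrix.mul_nonsing_inv _ (P.isUnit_det_D1 hk)]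
  · simp only [Matrix.mul_assoc]

theorem rotQ_projector {k : ℕ} (hk : k ≤ n) (x : Fin n → ℝ) :
    (P.Vᵀ *ᵥ ((1 - lanczosQ P.A P.b k * (lanczosQ P.A P.b k)ᵀ) *ᵥ x)) ∘ finSplit hk
      = (P.Vᵀ *ᵥ x) ∘ finSplit hk
        - P.rotQ hk *ᵥ ((P.rotQ hk)ᵀ *ᵥ ((P.Vᵀ *ᵥ x) ∘ finSplit hk)) := by
  have h1 : (P.rotQ hk)ᵀ *ᵥ ((P.Vᵀ *ᵥ x) ∘ finSplit hk) = (lanczosQ P.A P.b k)ᵀ *ᵥ x := by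
    rw [rotQ, Matrix.transpose_submatrix, Matrix.submatrix_mulVec_equiv]
    simp only [Function.comp_assoc, Equiv.self_comp_symm, Function.comp_id]
    rw [Matrix.mulVec_mulVec, Matrix.transpose_mul, Matrix.transpose_transpose, Matrix.mul_assoc,
      P.svd.mul_transpose_V, Matrix.mul_one]
  rw [h1, Matrix.sub_mulVec, Matrix.one_mulVec, Matrix.mulVec_sub, ← Matrix.mulVec_mulVec,
    Matrix.mulVec_mulVec _ P.Vᵀ]
  rfl

theorem gamma_eq (k : ℕ) :
    P.gamma k = ‖P.A * (1 - lanczosQ P.A P.b k * (lanczosQ P.A P.b k)ᵀ)‖ :=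
  lanczosError_eq P.A P.b k

theorem gamma_le {k : ℕ} (hk : k + 1 ≤ n) :
    P.gamma k ≤ Real.sqrt (1 + P.eta k ^ 2) * P.σ (k + 1) := by
  have hkn : k ≤ n := by omega
  have hσ : 0 < P.σ (k + 1) := P.svd.pos _ (by omega) hk
  have heps : P.eta k * P.σ (k + 1) = P.eps k := div_mul_cancel₀ _ hσ.ne'
  rw [gamma_eq]
  refine Matrix.l2_opNorm_le_of_dotProduct_le _ (by positivity) fun x => ?_
  rw [mul_pow, Real.sq_sqrt (by positivity), add_mul, one_mul, ← mul_pow, heps,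
    ← Matrix.mulVec_mulVec, P.svd.dotProduct_mulVec_self, ← (finSplit hkn).sum_comp,
    Fintype.sum_sum_type, add_comm, add_mul]
  have hproj := P.rotQ_projector hkn x
  set y := P.Vᵀ *ᵥ ((1 - lanczosQ P.A P.b k * (lanczosQ P.A P.b k)ᵀ) *ᵥ x)
  have hx : ((P.Vᵀ *ᵥ x) ∘ finSplit hkn) ⬝ᵥ ((P.Vᵀ *ᵥ x) ∘ finSplit hkn) = x ⬝ᵥ x := by
    have hV : P.Vᵀ ∈ Matrix.orthogonalGroup (Fin n) ℝ := by
      rw [Matrix.mem_orthogonalGroup_iff]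
      simpa using P.svd.transpose_mul_V
    rw [← Matrix.dotProduct_orthogonal_mulVec hV x]
    exact (finSplit hkn).sum_comp fun i => (P.Vᵀ *ᵥ x) i * (P.Vᵀ *ᵥ x) i
  refine add_le_add ?_ ?_
  -- Directions beyond `k`: each `σ_i ≤ σ_{k+1}`, and the complementary projector is a contraction.
  · calc ∑ i, P.σ ((finSplit hkn (Sum.inr i) : ℕ) + 1) ^ 2 * y (finSplit hkn (Sum.inr i)) ^ 2
        ≤ ∑ i, P.σ (k + 1) ^ 2 * y (finSplit hkn (Sum.inr i)) ^ 2 := by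
          refine Finset.sum_le_sum fun i _ => mul_le_mul_of_nonneg_right ?_ (sq_nonneg _)
          rw [finSplit_inr]
          exact pow_le_pow_left₀ (P.svd.pos _ (by omega) (by omega)).le
            (P.σ_anti (by omega) (by omega) (by omega)) 2
      _ = P.σ (k + 1) ^ 2 * ∑ i, y (finSplit hkn (Sum.inr i)) ^ 2 := by rw [Finset.mul_sum]
      _ ≤ P.σ (k + 1) ^ 2 * (x ⬝ᵥ x) := by
          refine mul_le_mul_of_nonneg_left ?_ (sq_nonneg _)
          have h1 := Matrix.dotProduct_sub_projector_le (P.transpose_mul_rotQ hkn)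
            ((P.Vᵀ *ᵥ x) ∘ finSplit hkn)
          rw [← hproj, hx] at h1
          refine le_trans ?_ h1
          simp only [dotProduct, Fintype.sum_sum_type, Function.comp_apply, ← sq]
          exact le_add_of_nonneg_left (Finset.sum_nonneg fun i _ => sq_nonneg _)
  -- First `k` directions: `Σ_k` times the upper block of the complementary projector, whose two
  -- pieces are exactly the matrices in `ε_k`.
  · obtain ⟨S, hS⟩ := P.exists_rotQ_mul_eq_fromRows hkn
    have h1 := Matrix.sub_projector_comp_inl (P.transpose_mul_rotQ hkn) hS
      ((P.Vᵀ *ᵥ x) ∘ finSplit hkn)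
    rw [← hproj] at h1
    set w := (P.Vᵀ *ᵥ x) ∘ finSplit hkn
    have h2 : P.Sig k *ᵥ ((y ∘ finSplit hkn) ∘ Sum.inl)
        = (P.Sig k * (1 + (P.Delta k)ᵀ * P.Delta k)⁻¹ * ((P.Delta k)ᵀ * P.Delta k))
            *ᵥ (w ∘ Sum.inl)
          - (P.Sig k * (1 + (P.Delta k)ᵀ * P.Delta k)⁻¹ * (P.Delta k)ᵀ) *ᵥ (w ∘ Sum.inr) := by
      rw [h1, Matrix.mulVec_sub, Matrix.mulVec_mulVec, Matrix.mulVec_mulVec, Matrix.mul_assoc,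
        Matrix.mul_assoc]
    have h3 : ∑ i, P.σ ((finSplit hkn (Sum.inl i) : ℕ) + 1) ^ 2 * y (finSplit hkn (Sum.inl i)) ^ 2
        = (P.Sig k *ᵥ ((y ∘ finSplit hkn) ∘ Sum.inl))
          ⬝ᵥ (P.Sig k *ᵥ ((y ∘ finSplit hkn) ∘ Sum.inl)) := by
      simp only [dotProduct, Sig, Matrix.mulVec_diagonal, finSplit_inl, Function.comp_apply]
      exact Finset.sum_congr rfl fun i _ => by ring
    rw [h3, h2, eps, Real.sq_sqrt (by positivity), ← hx]
    refine (Matrix.dotProduct_self_sub_le rfl rfl _ _).trans (le_of_eq ?_)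
    simp only [dotProduct, Fintype.sum_sum_type, Function.comp_apply]

theorem le_gamma {k : ℕ} (hk : k + 1 ≤ n) : P.σ (k + 1) ≤ P.gamma k := by
  have hσ : 0 < P.σ (k + 1) := P.svd.pos _ (by omega) hk
  set Q := lanczosQ P.A P.b k with hQ
  -- A kernel vector of `f` is orthogonal to the `k` columns of `VᵀQ` and supported on the first `k
  -- + 1` coordinates. These are `n - 1` linear conditions, so a nonzero one exists; `A (1 - QQᵀ)`
  -- stretches its image under `V` by at least `σ_{k+1}`.
  let f : (Fin n → ℝ) →ₗ[ℝ] (Fin k → ℝ) × (Fin (n - (k + 1)) → ℝ) :=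
    ((P.Vᵀ * Q)ᵀ).mulVecLin.prod
      (LinearMap.funLeft ℝ ℝ fun i : Fin (n - (k + 1)) => finSplit hk (Sum.inr i))
  have hker : LinearMap.ker f ≠ ⊥ := by
    refine LinearMap.ker_ne_bot_of_finrank_lt ?_
    simp
    omega
  obtain ⟨y, hy, hy0⟩ := Submodule.exists_mem_ne_zero_of_ne_bot hker
  rw [LinearMap.mem_ker] at hy
  have hy1 : (P.Vᵀ * Q)ᵀ *ᵥ y = 0 := congrArg Prod.fst hy
  have hy2 : ∀ i : Fin (n - (k + 1)), y (finSplit hk (Sum.inr i)) = 0 := fun i =>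
    congrFun (congrArg Prod.snd hy) i
  have hpos : 0 < y ⬝ᵥ y :=
    lt_of_le_of_ne (Matrix.dotProduct_self_nonneg_real y)
      fun h => hy0 (dotProduct_self_eq_zero.1 h.symm)
  have h1 : (P.V *ᵥ y) ⬝ᵥ (P.V *ᵥ y) = y ⬝ᵥ y :=
    Matrix.dotProduct_orthogonal_mulVec P.svd.orthV y
  have h2 := Matrix.dotProduct_mulVec_self_le (P.A * (1 - Q * Qᵀ)) (P.V *ᵥ y)
  have h3 : (1 - Q * Qᵀ) *ᵥ (P.V *ᵥ y) = P.V *ᵥ y := by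
    rw [Matrix.transpose_mul, Matrix.transpose_transpose, ← Matrix.mulVec_mulVec] at hy1
    rw [Matrix.sub_mulVec, Matrix.one_mulVec, ← Matrix.mulVec_mulVec, hy1, Matrix.mulVec_zero,
      sub_zero]
  rw [← Matrix.mulVec_mulVec, h3, P.svd.dotProduct_mulVec_self, h1, Matrix.mulVec_mulVec,
    P.svd.transpose_mul_V, Matrix.one_mulVec, ← (finSplit hk).sum_comp, Fintype.sum_sum_type] at h2
  have h4 : P.σ (k + 1) ^ 2 * (y ⬝ᵥ y) ≤ P.gamma k ^ 2 * (y ⬝ᵥ y) := by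
    rw [gamma_eq]
    refine le_trans ?_ h2
    have : y ⬝ᵥ y = ∑ i, y (finSplit hk (Sum.inl i)) ^ 2 := by
      simp only [dotProduct]
      rw [← (finSplit hk).sum_comp, Fintype.sum_sum_type]
      simp [hy2, sq]
    rw [this, Finset.mul_sum]
    refine le_add_of_le_of_nonneg (Finset.sum_le_sum fun i _ => ?_)
      (Finset.sum_nonneg fun i _ => by positivity)
    rw [finSplit_inl]
    exact mul_le_mul_of_nonneg_right
      (pow_le_pow_left₀ hσ.le (P.σ_anti (by omega) (by omega) (by omega)) 2) (sq_nonneg _)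
  have h5 := le_of_mul_le_mul_right h4 hpos
  exact le_of_sq_le_sq h5 (by rw [gamma_eq]; exact norm_nonneg _)

theorem xi_eq {k : ℕ} (h : ‖P.Delta k‖ < 1) :
    P.xi k = Real.sqrt ((‖P.Delta k‖ / (1 + ‖P.Delta k‖ ^ 2)) ^ 2 + 1) := by
  rw [xi, Matrix.norm_mul_inv_one_add_gram _ h]

theorem xi_le (k : ℕ) : P.xi k ≤ Real.sqrt 5 / 2 := by
  have h := Matrix.norm_mul_inv_one_add_gram_le_half (P.Delta k)
  have h0 := norm_nonneg (P.Delta k * (1 + (P.Delta k)ᵀ * P.Delta k)⁻¹)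
  rw [xi, Real.sqrt_le_left (by positivity), div_pow, Real.sq_sqrt (by norm_num)]
  nlinarith

theorem one_le_xi (k : ℕ) : 1 ≤ P.xi k := by
  rw [xi, Real.one_le_sqrt]
  exact le_add_of_nonneg_left (sq_nonneg _)

theorem eps_le (k : ℕ) : P.eps k ≤ P.xi k * ‖P.Delta k * P.Sig k‖ := by
  have h := Matrix.sqrt_norm_sq_add_norm_sq_le (P.Sig k) (P.Delta k)
  rwa [Sig, Matrix.diagonal_transpose] at h

end IllPosedProblem

/-! ### Lagrange polynomials and the general bound for `η_k`. -/

namespace IllPosedProblem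

variable {m n : ℕ} (P : IllPosedProblem m n)

/-- Interpolation at `k` nodes reproduces the monomials of degree below `k`; in matrix form, the
basis values times `T_{k1}` equal `T_{k2}`. -/
theorem T2_mul_inv_T1_apply {k : ℕ} (hk : k ≤ n) (i : Fin (n - k)) (j : Fin k) :
    (P.T2 k * (P.T1 k)⁻¹) i j
      = (Lagrange.basis Finset.univ (fun l : Fin k => P.σ (l + 1) ^ 2) j).eval
          (P.σ (k + i + 1) ^ 2) := by
  have h : (Matrix.of fun (i : Fin (n - k)) (j : Fin k) =>
      (Lagrange.basis Finset.univ (fun l : Fin k => P.σ (l + 1) ^ 2) j).eval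
        (P.σ (k + i + 1) ^ 2)) * P.T1 k = P.T2 k := by
    ext i l
    have h1 := Lagrange.eq_interpolate (s := Finset.univ)
      (v := fun l : Fin k => P.σ (l + 1) ^ 2) (f := Polynomial.X ^ (l : ℕ))
      ((P.sq_σ_injective hk).injOn) (by
        rw [Polynomial.degree_X_pow, Finset.card_univ, Fintype.card_fin]
        exact_mod_cast l.2)
    have h2 := congrArg (Polynomial.eval (P.σ (k + i + 1) ^ 2)) h1
    simp only [Lagrange.interpolate_apply, Polynomial.eval_finsetSum, Polynomial.eval_mul,
      Polynomial.eval_C, Polynomial.eval_pow, Polynomial.eval_X] at h2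
    rw [Matrix.mul_apply]
    simp only [T1, T2, Matrix.of_apply, pow_mul]
    rw [h2]
    exact Finset.sum_congr rfl fun _ _ => mul_comm _ _
  rw [← h, Matrix.mul_assoc, Matrix.mul_nonsing_inv _ (P.isUnit_det_T1 hk), Matrix.mul_one,
    Matrix.of_apply]

theorem lagrangeAtZero_eq_prod_fin {k : ℕ} (j : Fin k) :
    P.lagrangeAtZero k (j + 1) = ∏ i ∈ Finset.univ.erase j,
      P.σ (i + 1) ^ 2 / |P.σ (j + 1) ^ 2 - P.σ (i + 1) ^ 2| := by
  symm
  refine Finset.prod_bij (fun (i : Fin k) _ => (i : ℕ) + 1) ?_ ?_ ?_ ?_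
  · intro i hi
    have : i ≠ j := (Finset.mem_erase.1 hi).1
    simp only [Finset.mem_erase, Finset.mem_Icc]
    refine ⟨fun h => this (Fin.ext (by omega)), by omega, by omega⟩
  · intro i _ l _ h
    exact Fin.ext (by omega)
  · intro l hl
    simp only [Finset.mem_erase, Finset.mem_Icc] at hl
    refine ⟨⟨l - 1, by omega⟩, ?_, ?_⟩
    · simp only [Finset.mem_erase, Finset.mem_univ, and_true]
      exact fun h => hl.1 (by rw [← h]; simp only; omega)
    · simp only; omega
  · intro i _; rfl

theorem lagrangeAtZero_nonneg (k j : ℕ) : 0 ≤ P.lagrangeAtZero k j :=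
  Finset.prod_nonneg fun _ _ => by positivity

/-- The evaluation point lies between `0` and every node, so each numerator `|x - σ_l²|` is at most
its value `σ_l²` at `0`. -/
theorem abs_eval_basis_le {k : ℕ} (i : Fin (n - k)) (j : Fin k) :
    |(Lagrange.basis Finset.univ (fun l : Fin k => P.σ (l + 1) ^ 2) j).eval
        (P.σ (k + i + 1) ^ 2)| ≤ P.lagrangeAtZero k (j + 1) := by
  rw [lagrangeAtZero_eq_prod_fin, Lagrange.basis, Polynomial.eval_prod, Finset.abs_prod]
  refine Finset.prod_le_prod (fun _ _ => abs_nonneg _) fun l _ => ?_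
  simp only [Lagrange.basisDivisor, Polynomial.eval_mul, Polynomial.eval_C, Polynomial.eval_sub,
    Polynomial.eval_X]
  rw [abs_mul, abs_inv, div_eq_inv_mul]
  refine mul_le_mul_of_nonneg_left ?_ (by positivity)
  have h1 : 0 < P.σ (k + i + 1) := P.svd.pos _ (by omega) (by omega)
  have h2 := pow_le_pow_left₀ h1.le
    (P.σ_anti (i := l + 1) (j := k + i + 1) (by omega) (by omega) (by omega)) 2
  rw [abs_sub_comm, abs_of_nonneg (by linarith)]
  linarith [sq_nonneg (P.σ (k + i + 1))]

theorem Delta_mul_Sig_apply {k : ℕ} (hk : k ≤ n) (i : Fin (n - k)) (j : Fin k) :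
    (P.Delta k * P.Sig k) i j = P.σ (k + i + 1) * P.c (k + i + 1)
      * (Lagrange.basis Finset.univ (fun l : Fin k => P.σ (l + 1) ^ 2) j).eval
          (P.σ (k + i + 1) ^ 2) / P.c (j + 1) := by
  have hσ : P.σ (j + 1) ≠ 0 := (P.svd.pos _ (by omega) (by omega)).ne'
  have hc : P.c (j + 1) ≠ 0 := P.c_ne_zero (by omega) (by omega)
  have hD1 : (P.D1 k)⁻¹ = Matrix.diagonal fun i : Fin k => (P.σ (i + 1) * P.c (i + 1))⁻¹ := by
    refine Matrix.inv_eq_right_inv ?_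
    rw [D1, Matrix.diagonal_mul_diagonal, ← Matrix.diagonal_one]
    congr 1
    ext l
    exact mul_inv_cancel₀ (mul_ne_zero (P.svd.pos _ (by omega) (by omega)).ne'
      (P.c_ne_zero (by omega) (by omega)))
  rw [Delta, hD1, Sig, Matrix.mul_diagonal, Matrix.mul_diagonal, Matrix.mul_assoc, D2,
    Matrix.diagonal_mul, P.T2_mul_inv_T1_apply hk]
  field_simp

theorem sq_Delta_mul_Sig_le {k : ℕ} (h1 : 1 ≤ k) (hk : k ≤ n) (i : Fin (n - k)) (j : Fin k) :
    (P.Delta k * P.Sig k) i j ^ 2 ≤ (|P.c (k + 1)| / |P.c k|) ^ 2 * (P.σ (k + i + 1) ^ 2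
      * ((P.c k / P.c (j + 1)) ^ 2 * P.lagrangeAtZero k (j + 1) ^ 2)) := by
  have hck : P.c k ≠ 0 := P.c_ne_zero h1 hk
  have hc : P.c (j + 1) ≠ 0 := P.c_ne_zero (by omega) (by omega)
  rw [P.Delta_mul_Sig_apply hk]
  have hL := pow_le_pow_left₀ (abs_nonneg _) (P.abs_eval_basis_le i j) 2
  rw [sq_abs] at hL
  have hcc : P.c (k + i + 1) ^ 2 ≤ P.c (k + 1) ^ 2 :=
    sq_le_sq.2 (P.abs_c_anti (by omega) (by omega) (by omega))
  rw [div_pow, mul_pow, mul_pow]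
  calc P.σ (k + i + 1) ^ 2 * P.c (k + i + 1) ^ 2 * _ / P.c (j + 1) ^ 2
      ≤ P.σ (k + i + 1) ^ 2 * P.c (k + 1) ^ 2 * P.lagrangeAtZero k (j + 1) ^ 2
        / P.c (j + 1) ^ 2 := by gcongr
    _ = _ := by
      rw [div_pow, div_pow, sq_abs, sq_abs]
      field_simp

/-- A bound for `η_k` by the tail of the squared singular values and the Lagrange polynomials. -/
theorem eta_le {k : ℕ} (h1 : 1 ≤ k) (hk : k + 1 ≤ n) {r u v : ℝ} (hr : 0 ≤ r)
    (hu : ∑ i : Fin (n - k), P.σ (k + i + 1) ^ 2 ≤ P.σ (k + 1) ^ 2 * (r ^ 2 * u))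
    (hv : ∑ j : Fin k, (P.c k / P.c (j + 1)) ^ 2 * P.lagrangeAtZero k (j + 1) ^ 2 ≤ v) :
    P.eta k ≤ P.xi k * r * (|P.c (k + 1)| / |P.c k|) * Real.sqrt (u * v) := by
  have hσ : 0 < P.σ (k + 1) := P.svd.pos _ (by omega) hk
  have hxi : 0 ≤ P.xi k := zero_le_one.trans (P.one_le_xi k)
  have hv0 : 0 ≤ v := le_trans (Finset.sum_nonneg fun _ _ => by positivity) hv
  rw [eta, div_le_iff₀ hσ]
  refine (P.eps_le k).trans ?_
  have h2 : ‖P.Delta k * P.Sig k‖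
      ≤ r * (|P.c (k + 1)| / |P.c k|) * P.σ (k + 1) * Real.sqrt (u * v) := by
    refine (Matrix.l2_opNorm_le_sqrt_sum_sq _).trans ?_
    rw [← Real.sqrt_sq (by positivity : 0 ≤ r * (|P.c (k + 1)| / |P.c k|) * P.σ (k + 1)),
      ← Real.sqrt_mul (sq_nonneg _)]
    refine Real.sqrt_le_sqrt ?_
    -- The entrywise bound is a function of `i` times a function of `j`, so the double sum factors.
    calc ∑ i, ∑ j, (P.Delta k * P.Sig k) i j ^ 2
        ≤ ∑ i : Fin (n - k), ∑ j : Fin k, (|P.c (k + 1)| / |P.c k|) ^ 2 * (P.σ (k + i + 1) ^ 2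
          * ((P.c k / P.c (j + 1)) ^ 2 * P.lagrangeAtZero k (j + 1) ^ 2)) :=
          Finset.sum_le_sum fun i _ => Finset.sum_le_sum fun j _ =>
            P.sq_Delta_mul_Sig_le h1 (by omega) i j
      _ = (|P.c (k + 1)| / |P.c k|) ^ 2 * ((∑ i : Fin (n - k), P.σ (k + i + 1) ^ 2)
          * ∑ j : Fin k, (P.c k / P.c (j + 1)) ^ 2 * P.lagrangeAtZero k (j + 1) ^ 2) := by
          rw [Finset.sum_mul_sum]
          simp only [Finset.mul_sum]
      _ ≤ (|P.c (k + 1)| / |P.c k|) ^ 2 * ((∑ i : Fin (n - k), P.σ (k + i + 1) ^ 2) * v) := by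
          gcongr
      _ ≤ (|P.c (k + 1)| / |P.c k|) ^ 2 * ((P.σ (k + 1) ^ 2 * (r ^ 2 * u)) * v) := by
          gcongr
      _ = _ := by ring
  calc P.xi k * ‖P.Delta k * P.Sig k‖
      ≤ P.xi k * (r * (|P.c (k + 1)| / |P.c k|) * P.σ (k + 1) * Real.sqrt (u * v)) :=
        mul_le_mul_of_nonneg_left h2 hxi
    _ = _ := by ring

theorem abs_c_eq_η {j : ℕ} (h : P.k₀ < j) (hn : j ≤ n) : |P.c j| = P.η :=
  P.coeff_noise j h hn

end IllPosedProblem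

/-! ### Severely ill-posed problems. -/

theorem sum_range_geometric_le {θ : ℝ} (h0 : 0 ≤ θ) (h1 : θ < 1) (N : ℕ) :
    ∑ i ∈ Finset.range N, θ ^ i ≤ (1 - θ)⁻¹ := by
  rw [← tsum_geometric_of_lt_one h0 h1]
  exact (summable_geometric_of_lt_one h0 h1).sum_le_tsum _ fun i _ => pow_nonneg h0 i

theorem summable_prod_range_mul_geometric {a θ : ℝ} (ha : 0 < a) (h0 : 0 < θ) (h1 : θ < 1) :
    Summable fun s : ℕ => ∏ d ∈ Finset.range s, (a * θ ^ d) ^ 2 := by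
  refine summable_of_ratio_test_tendsto_lt_one (l := 0) zero_lt_one
    (Filter.Eventually.of_forall fun s => Finset.prod_ne_zero_iff.2 fun d _ => by positivity) ?_
  have h2 : (fun s : ℕ => ‖∏ d ∈ Finset.range (s + 1), (a * θ ^ d) ^ 2‖
      / ‖∏ d ∈ Finset.range s, (a * θ ^ d) ^ 2‖) = fun s : ℕ => (a * θ ^ s) ^ 2 := by
    ext s
    have : 0 < ∏ d ∈ Finset.range s, (a * θ ^ d) ^ 2 :=
      Finset.prod_pos fun d _ => by positivity
    rw [Finset.prod_range_succ, norm_mul, mul_comm, mul_div_assoc,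
      div_self (norm_ne_zero_iff.2 this.ne'),
      mul_one, Real.norm_of_nonneg (by positivity)]
  rw [h2]
  have h3 := ((tendsto_pow_atTop_nhds_zero_of_lt_one h0.le h1).const_mul a).pow 2
  simpa using h3

/-- `1 - x ≤ e^{-x}` gives `e^x ≤ 1 + x e^x`, used with `x = bt ≤ b`. -/
theorem Real.exp_mul_le_one_add {b t : ℝ} (hb : 0 ≤ b) (h0 : 0 ≤ t) (h1 : t ≤ 1) :
    Real.exp (b * t) ≤ 1 + b * Real.exp b * t := by
  have h2 := Real.add_one_le_exp (-(b * t))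
  have h3 : Real.exp (b * t) * Real.exp (-(b * t)) = 1 := by rw [← Real.exp_add]; simp
  have h4 : Real.exp (b * t) ≤ Real.exp b := Real.exp_le_exp.2 (by nlinarith)
  have h5 := Real.exp_pos (b * t)
  have h6 : 0 ≤ b * t := mul_nonneg hb h0
  nlinarith

namespace IllPosedProblem.IsSevere

variable {m n : ℕ} {P : IllPosedProblem m n} {ρ κ δ : ℝ}

theorem inv_sq_pos (h : P.IsSevere ρ κ δ) : 0 < (ρ ^ 2)⁻¹ := by
  have := h.one_lt
  positivity

theorem inv_sq_le_one (h : P.IsSevere ρ κ δ) : (ρ ^ 2)⁻¹ ≤ 1 :=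
  inv_le_one_of_one_le₀ (one_le_pow₀ h.one_lt.le)

theorem gap_pow (h : P.IsSevere ρ κ δ) (hδ : 0 < δ) {j : ℕ} (d : ℕ) (hj : 1 ≤ j)
    (hn : j + d ≤ n) : P.σ (j + d) ≤ δ ^ d * P.σ j := by
  induction d with
  | zero => simp
  | succ d ih =>
    calc P.σ (j + (d + 1)) ≤ δ * P.σ (j + d) := h.gap (j + d) (by omega) hn
      _ ≤ δ * (δ ^ d * P.σ j) := mul_le_mul_of_nonneg_left (ih (by omega)) hδ.le
      _ = _ := by ring

/-- One factor `ρ⁻²` is kept and the rest becomes a ratio `θ = max(δ², 1/4) < 1` free of `ρ`. For `ρ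
≥ 2` the decay condition suffices, as `ρ⁻² ≤ 1/4`. For `ρ < 2` that ratio is not bounded away from
`1`, but there `4ρ⁻² ≥ 1`, and the gap condition supplies the ratio `δ²`. -/
theorem sq_decay (h : P.IsSevere ρ κ δ) (hδ : 0 < δ) (hδ1 : δ < 1) {j : ℕ} (d : ℕ)
    (hj : 1 ≤ j) (hn : j + (d + 1) ≤ n) :
    P.σ (j + (d + 1)) ^ 2
      ≤ max (κ ^ 2) 4 * (ρ ^ 2)⁻¹ * max (δ ^ 2) (1 / 4) ^ d * P.σ j ^ 2 := by
  have hσ : 0 < P.σ (j + (d + 1)) := P.svd.pos _ (by omega) hn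
  have ht := h.inv_sq_pos
  have hρ : 0 < ρ := zero_lt_one.trans h.one_lt
  rcases le_or_gt 2 ρ with h2 | h2
  · have h1 := pow_le_pow_left₀ hσ.le (h.decay j (d + 1) hj hn) 2
    have ht4 : (ρ ^ 2)⁻¹ ≤ 1 / 4 := by
      rw [one_div]
      exact inv_anti₀ (by norm_num) (by nlinarith)
    calc P.σ (j + (d + 1)) ^ 2 ≤ (κ * (ρ ^ (d + 1))⁻¹ * P.σ j) ^ 2 := h1
      _ = κ ^ 2 * (ρ ^ 2)⁻¹ * (ρ ^ 2)⁻¹ ^ d * P.σ j ^ 2 := by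
        rw [mul_pow, mul_pow, inv_pow, inv_pow, ← pow_mul, ← pow_mul,
          show (d + 1) * 2 = 2 + 2 * d by ring, pow_add, mul_inv]
        ring
      _ ≤ _ := by
        gcongr
        · exact le_max_left _ _
        · exact ht4.trans (le_max_right _ _)
  · have h1 := pow_le_pow_left₀ hσ.le (h.gap_pow hδ (d + 1) hj hn) 2
    have ht4 : 1 / 4 ≤ (ρ ^ 2)⁻¹ := by
      rw [one_div]
      exact inv_anti₀ (by positivity) (by nlinarith)
    have hδ2 : δ ^ 2 ≤ 1 := pow_le_one₀ hδ.le hδ1.le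
    calc P.σ (j + (d + 1)) ^ 2 ≤ (δ ^ (d + 1) * P.σ j) ^ 2 := h1
      _ = δ ^ 2 * (δ ^ 2) ^ d * P.σ j ^ 2 := by ring
      _ ≤ 1 * max (δ ^ 2) (1 / 4) ^ d * P.σ j ^ 2 := by
        gcongr
        exact le_max_left _ _
      _ ≤ _ := by
        gcongr
        calc (1 : ℝ) ≤ 4 * (ρ ^ 2)⁻¹ := by linarith
          _ ≤ _ := by gcongr; exact le_max_right _ _

theorem sq_gap (h : P.IsSevere ρ κ δ) {i j : ℕ} (hi : 1 ≤ i)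
    (hij : i < j) (hn : j ≤ n) : P.σ j ^ 2 ≤ δ ^ 2 * P.σ i ^ 2 := by
  have h1 := h.gap i hi (by omega)
  have h2 := P.σ_anti (i := i + 1) (j := j) (by omega) (by omega) hn
  rw [← mul_pow]
  exact pow_le_pow_left₀ (P.svd.pos _ (by omega) hn).le (h2.trans h1) 2

theorem sum_sq_tail_le (h : P.IsSevere ρ κ δ) (hδ : 0 < δ) (hδ1 : δ < 1) {k : ℕ}
    (hk : k + 1 ≤ n) :
    ∑ i : Fin (n - k), P.σ (k + i + 1) ^ 2 ≤ P.σ (k + 1) ^ 2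
      * (1 + max (κ ^ 2) 4 * (1 - max (δ ^ 2) (1 / 4))⁻¹ * (ρ ^ 2)⁻¹) := by
  have hθ0 : 0 ≤ max (δ ^ 2) (1 / 4 : ℝ) := le_max_of_le_left (sq_nonneg _)
  have hθ1 : max (δ ^ 2) (1 / 4 : ℝ) < 1 :=
    max_lt (pow_lt_one₀ hδ.le hδ1 two_ne_zero) (by norm_num)
  have hM : 0 ≤ max (κ ^ 2) (4 : ℝ) := le_max_of_le_left (sq_nonneg _)
  have ht := h.inv_sq_pos
  rw [Fin.sum_univ_eq_sum_range (fun i => P.σ (k + i + 1) ^ 2),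
    show n - k = (n - k - 1) + 1 by omega, Finset.sum_range_succ', add_comm, mul_add, mul_one]
  refine add_le_add le_rfl ?_
  calc ∑ i ∈ Finset.range (n - k - 1), P.σ (k + (i + 1) + 1) ^ 2
      ≤ ∑ i ∈ Finset.range (n - k - 1), max (κ ^ 2) 4 * (ρ ^ 2)⁻¹ * P.σ (k + 1) ^ 2
          * max (δ ^ 2) (1 / 4) ^ i := by
        refine Finset.sum_le_sum fun i hi => ?_
        have hi' := Finset.mem_range.1 hi
        have := h.sq_decay hδ hδ1 (j := k + 1) i (by omega) (by omega)
        rw [show k + (i + 1) + 1 = k + 1 + (i + 1) by ring]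
        linarith
    _ = max (κ ^ 2) 4 * (ρ ^ 2)⁻¹ * P.σ (k + 1) ^ 2
          * ∑ i ∈ Finset.range (n - k - 1), max (δ ^ 2) (1 / 4) ^ i := by rw [Finset.mul_sum]
    _ ≤ max (κ ^ 2) 4 * (ρ ^ 2)⁻¹ * P.σ (k + 1) ^ 2 * (1 - max (δ ^ 2) (1 / 4))⁻¹ := by
        gcongr
        exact sum_range_geometric_le hθ0 hθ1 _
    _ = _ := by ring

theorem lower_factor_le (h : P.IsSevere ρ κ δ) (hδ : 0 < δ) (hδ1 : δ < 1) {i d : ℕ} (hi : 1 ≤ i)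
    (hn : i + (d + 1) ≤ n) :
    P.σ i ^ 2 / |P.σ (i + (d + 1)) ^ 2 - P.σ i ^ 2|
      ≤ 1 + max (κ ^ 2) 4 / (1 - δ ^ 2) * (ρ ^ 2)⁻¹ * max (δ ^ 2) (1 / 4) ^ d := by
  have hσ : 0 < P.σ i := P.svd.pos _ hi (by omega)
  have hδ2 : 0 < 1 - δ ^ 2 := sub_pos.2 (pow_lt_one₀ hδ.le hδ1 two_ne_zero)
  have h1 := h.sq_decay hδ hδ1 d hi hn
  have h2 := h.sq_gap (j := i + (d + 1)) hi (by omega) hn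
  have h3 : 0 < (1 - δ ^ 2) * P.σ i ^ 2 := by positivity
  have h4 : (1 - δ ^ 2) * P.σ i ^ 2 ≤ P.σ i ^ 2 - P.σ (i + (d + 1)) ^ 2 := by linarith
  -- A node larger than `σ_j²` gives a factor close to `1`; only the excess over `1` is of order
  -- `ρ⁻²`.
  have h5 : P.σ i ^ 2 / (P.σ i ^ 2 - P.σ (i + (d + 1)) ^ 2)
      = 1 + P.σ (i + (d + 1)) ^ 2 / (P.σ i ^ 2 - P.σ (i + (d + 1)) ^ 2) := by
    rw [eq_comm, one_add_div (by linarith), sub_add_cancel]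
  rw [abs_sub_comm, abs_of_pos (by linarith), h5]
  refine add_le_add le_rfl ?_
  calc P.σ (i + (d + 1)) ^ 2 / (P.σ i ^ 2 - P.σ (i + (d + 1)) ^ 2)
      ≤ (max (κ ^ 2) 4 * (ρ ^ 2)⁻¹ * max (δ ^ 2) (1 / 4) ^ d * P.σ i ^ 2)
        / ((1 - δ ^ 2) * P.σ i ^ 2) :=
        div_le_div₀ ((sq_nonneg _).trans h1) h1 h3 h4
    _ = _ := by field_simp

theorem upper_factor_le (h : P.IsSevere ρ κ δ) (hδ : 0 < δ) (hδ1 : δ < 1) {j d : ℕ} (hj : 1 ≤ j)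
    (hn : j + (d + 1) ≤ n) :
    P.σ (j + (d + 1)) ^ 2 / |P.σ j ^ 2 - P.σ (j + (d + 1)) ^ 2|
      ≤ max (κ ^ 2) 4 / (1 - δ ^ 2) * (ρ ^ 2)⁻¹ * max (δ ^ 2) (1 / 4) ^ d := by
  have hσ : 0 < P.σ j := P.svd.pos _ hj (by omega)
  have hδ2 : 0 < 1 - δ ^ 2 := sub_pos.2 (pow_lt_one₀ hδ.le hδ1 two_ne_zero)
  have h1 := h.sq_decay hδ hδ1 d hj hn
  have h2 := h.sq_gap (j := j + (d + 1)) hj (by omega) hn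
  have h3 : 0 < (1 - δ ^ 2) * P.σ j ^ 2 := by positivity
  have h4 : (1 - δ ^ 2) * P.σ j ^ 2 ≤ P.σ j ^ 2 - P.σ (j + (d + 1)) ^ 2 := by linarith
  rw [abs_of_pos (by linarith)]
  calc P.σ (j + (d + 1)) ^ 2 / (P.σ j ^ 2 - P.σ (j + (d + 1)) ^ 2)
      ≤ (max (κ ^ 2) 4 * (ρ ^ 2)⁻¹ * max (δ ^ 2) (1 / 4) ^ d * P.σ j ^ 2)
        / ((1 - δ ^ 2) * P.σ j ^ 2) :=
        div_le_div₀ ((sq_nonneg _).trans h1) h1 h3 h4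
    _ = _ := by field_simp

/-- Factors with index below `j` multiply to at most an exponential, by `1 + x ≤ e^x` and a
geometric series. Each of the `s` factors above `j` is itself of order `ρ⁻²`. -/
theorem lagrangeAtZero_le (h : P.IsSevere ρ κ δ) (hδ : 0 < δ) (hδ1 : δ < 1) {j s : ℕ}
    (hj : 1 ≤ j) (hn : j + s ≤ n) :
    P.lagrangeAtZero (j + s) j
      ≤ Real.exp (max (κ ^ 2) 4 / (1 - δ ^ 2) * (1 - max (δ ^ 2) (1 / 4))⁻¹ * (ρ ^ 2)⁻¹)
        * ∏ d ∈ Finset.range s,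
          (max (κ ^ 2) 4 / (1 - δ ^ 2) * (ρ ^ 2)⁻¹ * max (δ ^ 2) (1 / 4) ^ d) := by
  have hθ0 : 0 ≤ max (δ ^ 2) (1 / 4 : ℝ) := le_max_of_le_left (sq_nonneg _)
  have hθ1 : max (δ ^ 2) (1 / 4 : ℝ) < 1 :=
    max_lt (pow_lt_one₀ hδ.le hδ1 two_ne_zero) (by norm_num)
  have hδ2 : 0 < 1 - δ ^ 2 := sub_pos.2 (pow_lt_one₀ hδ.le hδ1 two_ne_zero)
  have hM : 0 < max (κ ^ 2) (4 : ℝ) := lt_max_of_lt_right (by norm_num)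
  have ht := h.inv_sq_pos
  have hsplit : (Finset.Icc 1 (j + s)).erase j
      = Finset.Ico 1 j ∪ Finset.Ico (j + 1) (j + s + 1) := by
    ext i
    simp only [Finset.mem_erase, Finset.mem_Icc, Finset.mem_union, Finset.mem_Ico]
    omega
  have hdisj : Disjoint (Finset.Ico 1 j) (Finset.Ico (j + 1) (j + s + 1)) := by
    rw [Finset.disjoint_left]
    intro i
    simp only [Finset.mem_Ico]
    omega
  rw [lagrangeAtZero, hsplit, Finset.prod_union hdisj, Finset.prod_Ico_eq_prod_range,
    Finset.prod_Ico_eq_prod_range]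
  refine mul_le_mul ?_ ?_ (Finset.prod_nonneg fun _ _ => by positivity) (Real.exp_pos _).le
  -- Reflection makes `d + 1` the distance from the index to `j`.
  · rw [← Finset.prod_range_reflect]
    calc ∏ d ∈ Finset.range (j - 1), P.σ (1 + (j - 1 - 1 - d)) ^ 2
          / |P.σ j ^ 2 - P.σ (1 + (j - 1 - 1 - d)) ^ 2|
        ≤ ∏ d ∈ Finset.range (j - 1), Real.exp
          (max (κ ^ 2) 4 / (1 - δ ^ 2) * (ρ ^ 2)⁻¹ * max (δ ^ 2) (1 / 4) ^ d) := by
          refine Finset.prod_le_prod (fun _ _ => by positivity) fun d hd => ?_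
          have hd' := Finset.mem_range.1 hd
          have h1 := h.lower_factor_le hδ hδ1 (i := 1 + (j - 1 - 1 - d)) (d := d) (by omega)
            (by omega)
          rw [show 1 + (j - 1 - 1 - d) + (d + 1) = j by omega] at h1
          refine h1.trans ?_
          rw [add_comm]
          exact Real.add_one_le_exp _
      _ ≤ _ := by
          rw [← Real.exp_sum, ← Finset.mul_sum]
          refine Real.exp_le_exp.2 ?_
          calc _ ≤ max (κ ^ 2) 4 / (1 - δ ^ 2) * (ρ ^ 2)⁻¹ * (1 - max (δ ^ 2) (1 / 4))⁻¹ := by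
                gcongr
                exact sum_range_geometric_le hθ0 hθ1 _
            _ = _ := by ring
  · rw [show j + s + 1 - (j + 1) = s by omega]
    refine Finset.prod_le_prod (fun _ _ => by positivity) fun d hd => ?_
    have hd' := Finset.mem_range.1 hd
    rw [show j + 1 + d = j + (d + 1) by ring]
    exact h.upper_factor_le hδ hδ1 hj (by omega)

theorem sum_sq_lagrangeAtZero_le (h : P.IsSevere ρ κ δ) (hδ : 0 < δ) (hδ1 : δ < 1) {k : ℕ}
    (h1k : 1 ≤ k) (hn : k ≤ n) :
    ∑ j : Fin k, P.lagrangeAtZero k (j + 1) ^ 2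
      ≤ Real.exp (2 * (max (κ ^ 2) 4 / (1 - δ ^ 2) * (1 - max (δ ^ 2) (1 / 4))⁻¹) * (ρ ^ 2)⁻¹)
        * (1 + (∑' s : ℕ, ∏ d ∈ Finset.range s,
          (max (κ ^ 2) 4 / (1 - δ ^ 2) * max (δ ^ 2) (1 / 4) ^ d) ^ 2) * (ρ ^ 2)⁻¹) := by
  have hθ0 : 0 < max (δ ^ 2) (1 / 4 : ℝ) := lt_max_of_lt_right (by norm_num)
  have hθ1 : max (δ ^ 2) (1 / 4 : ℝ) < 1 :=
    max_lt (pow_lt_one₀ hδ.le hδ1 two_ne_zero) (by norm_num)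
  have hδ2 : 0 < 1 - δ ^ 2 := sub_pos.2 (pow_lt_one₀ hδ.le hδ1 two_ne_zero)
  have hM : 0 < max (κ ^ 2) (4 : ℝ) := lt_max_of_lt_right (by norm_num)
  have ha : 0 < max (κ ^ 2) 4 / (1 - δ ^ 2) := by positivity
  have ht := h.inv_sq_pos
  have ht1 := h.inv_sq_le_one
  have hL : ∀ s < k, P.lagrangeAtZero k (k - 1 - s + 1) ^ 2
      ≤ Real.exp (2 * (max (κ ^ 2) 4 / (1 - δ ^ 2) * (1 - max (δ ^ 2) (1 / 4))⁻¹) * (ρ ^ 2)⁻¹)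
        * ∏ d ∈ Finset.range s,
          (max (κ ^ 2) 4 / (1 - δ ^ 2) * (ρ ^ 2)⁻¹ * max (δ ^ 2) (1 / 4) ^ d) ^ 2 := by
    intro s hs
    have h1 := h.lagrangeAtZero_le hδ hδ1 (j := k - 1 - s + 1) (s := s) (by omega) (by omega)
    rw [show k - 1 - s + 1 + s = k by omega] at h1
    have h2 := pow_le_pow_left₀ (P.lagrangeAtZero_nonneg _ _) h1 2
    rw [mul_pow, ← Finset.prod_pow, sq (Real.exp _), ← Real.exp_add, ← two_mul, ← mul_assoc] at h2
    exact h2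
  generalize max (κ ^ 2) 4 / (1 - δ ^ 2) = a at *
  generalize max (δ ^ 2) (1 / 4) = θ at *
  generalize (ρ ^ 2)⁻¹ = t at *
  set F : ℕ → ℝ := fun s => ∏ d ∈ Finset.range s, (a * θ ^ d) ^ 2 with hF
  have hFs : Summable F := summable_prod_range_mul_geometric ha hθ0 hθ1
  have hF0 : ∀ s, 0 ≤ F s := fun s => Finset.prod_nonneg fun _ _ => sq_nonneg _
  -- With `s = k - j` in the final sum, `s = 0` contributes the `1`; every other term carries a
  -- power `t^{2s} ≤ t`, where `t = ρ⁻² ≤ 1`.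
  have hFt : ∀ s, ∏ d ∈ Finset.range (s + 1), (a * t * θ ^ d) ^ 2 ≤ t * F (s + 1) := by
    intro s
    have h1 : ∀ d, (a * t * θ ^ d) ^ 2 = t ^ 2 * (a * θ ^ d) ^ 2 := fun d => by ring
    simp only [h1, Finset.prod_mul_distrib, Finset.prod_const, Finset.card_range]
    refine mul_le_mul_of_nonneg_right ?_ (hF0 _)
    calc (t ^ 2) ^ (s + 1) = t ^ (2 * (s + 1)) := by rw [pow_mul]
      _ ≤ t ^ 1 := pow_le_pow_of_le_one ht.le ht1 (by omega)
      _ = t := pow_one t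
  rw [Fin.sum_univ_eq_sum_range (fun j => P.lagrangeAtZero k (j + 1) ^ 2),
    ← Finset.sum_range_reflect]
  refine (Finset.sum_le_sum fun s hs => hL s (Finset.mem_range.1 hs)).trans ?_
  rw [← Finset.mul_sum]
  refine mul_le_mul_of_nonneg_left ?_ (Real.exp_pos _).le
  obtain ⟨N, rfl⟩ : ∃ N, k = N + 1 := ⟨k - 1, by omega⟩
  rw [Finset.sum_range_succ', Finset.prod_range_zero, add_comm]
  refine add_le_add le_rfl ?_
  calc ∑ s ∈ Finset.range N, ∏ d ∈ Finset.range (s + 1), (a * t * θ ^ d) ^ 2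
      ≤ ∑ s ∈ Finset.range N, t * F (s + 1) := Finset.sum_le_sum fun s _ => hFt s
    _ = t * ∑ s ∈ Finset.range N, F (s + 1) := by rw [Finset.mul_sum]
    _ ≤ t * ∑' s, F s := by
        refine mul_le_mul_of_nonneg_left ?_ ht.le
        have h2 : ∑ s ∈ Finset.range N, F (s + 1) ≤ ∑ s ∈ Finset.range (N + 1), F s := by
          rw [Finset.sum_range_succ']
          exact le_add_of_nonneg_right (hF0 0)
        exact h2.trans (hFs.sum_le_tsum _ fun i _ => hF0 i)
    _ = _ := mul_comm _ _

end IllPosedProblem.IsSevere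

/-- For `t ≤ 1` the product `(1 + yt)(1 + zt)` is at most `1 + wt` with `w = y + z + yz`, and `(1 +
xt)(1 + wt) ≤ (1 + (x + w)t)²`. -/
theorem sqrt_prod_one_add_mul_le {x y z t : ℝ} (hx : 0 ≤ x) (hy : 0 ≤ y) (hz : 0 ≤ z)
    (ht : 0 ≤ t) (ht1 : t ≤ 1) :
    Real.sqrt ((1 + x * t) * ((1 + y * t) * (1 + z * t))) ≤ 1 + (x + y + z + y * z) * t := by
  rw [Real.sqrt_le_left (by positivity)]
  have h1 : (1 + y * t) * (1 + z * t) ≤ 1 + (y + z + y * z) * t := by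
    have : y * z * (t * t) ≤ y * z * t := by
      refine mul_le_mul_of_nonneg_left ?_ (mul_nonneg hy hz)
      nlinarith
    nlinarith
  have hyz : 0 ≤ y + z + y * z := by positivity
  calc (1 + x * t) * ((1 + y * t) * (1 + z * t))
      ≤ (1 + x * t) * (1 + (y + z + y * z) * t) := by gcongr
    _ ≤ (1 + (x + (y + z + y * z)) * t) * (1 + (x + (y + z + y * z)) * t) :=
        mul_le_mul (by nlinarith) (by nlinarith) (by positivity) (by positivity)
    _ = _ := by ring

/-- The coefficients `c_j` enter only through nonvanishing and monotonicity, so one estimate serves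
on both sides of `k₀`. -/
theorem IllPosedProblem.exists_eta_le_of_isSevere (κ : ℝ) {δ : ℝ} (hδ : 0 < δ) (hδ1 : δ < 1) :
    ∃ C : ℝ, 0 < C ∧ ∀ (m n : ℕ) (P : IllPosedProblem m n) (ρ : ℝ), P.IsSevere ρ κ δ →
      ∀ k : ℕ, 1 ≤ k → k + 1 ≤ n →
        P.eta k ≤ P.xi k * (|P.c (k + 1)| / |P.c k|) * (1 + C * (ρ ^ 2)⁻¹) := by
  have hθ1 : max (δ ^ 2) (1 / 4 : ℝ) < 1 :=
    max_lt (pow_lt_one₀ hδ.le hδ1 two_ne_zero) (by norm_num)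
  have hθ2 : 0 < 1 - max (δ ^ 2) (1 / 4 : ℝ) := sub_pos.2 hθ1
  have hδ2 : 0 < 1 - δ ^ 2 := sub_pos.2 (pow_lt_one₀ hδ.le hδ1 two_ne_zero)
  have hM : 0 < max (κ ^ 2) (4 : ℝ) := lt_max_of_lt_right (by norm_num)
  -- `x` comes from the tail of the `σ_i²`, `b` from the squared Lagrange factors below `j`, and `z`
  -- from those above `j`.
  set x : ℝ := max (κ ^ 2) 4 * (1 - max (δ ^ 2) (1 / 4))⁻¹ with hx
  set b : ℝ := 2 * (max (κ ^ 2) 4 / (1 - δ ^ 2) * (1 - max (δ ^ 2) (1 / 4))⁻¹) with hb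
  set z : ℝ := ∑' s : ℕ, ∏ d ∈ Finset.range s,
    (max (κ ^ 2) 4 / (1 - δ ^ 2) * max (δ ^ 2) (1 / 4) ^ d) ^ 2 with hz
  have hx0 : 0 < x := by positivity
  have hb0 : 0 ≤ b := by positivity
  have hz0 : 0 ≤ z := tsum_nonneg fun s => Finset.prod_nonneg fun _ _ => sq_nonneg _
  have hy0 : 0 ≤ b * Real.exp b := by positivity
  refine ⟨x + b * Real.exp b + z + b * Real.exp b * z, by positivity, ?_⟩
  intro m n P ρ h k h1 hk
  have ht := h.inv_sq_pos
  have ht1 := h.inv_sq_le_one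
  have hS : ∑ i : Fin (n - k), P.σ (k + i + 1) ^ 2
      ≤ P.σ (k + 1) ^ 2 * (1 ^ 2 * (1 + x * (ρ ^ 2)⁻¹)) := by
    rw [one_pow, one_mul]
    exact h.sum_sq_tail_le hδ hδ1 hk
  have hT : ∑ j : Fin k, (P.c k / P.c (j + 1)) ^ 2 * P.lagrangeAtZero k (j + 1) ^ 2
      ≤ (1 + b * Real.exp b * (ρ ^ 2)⁻¹) * (1 + z * (ρ ^ 2)⁻¹) := by
    calc ∑ j : Fin k, (P.c k / P.c (j + 1)) ^ 2 * P.lagrangeAtZero k (j + 1) ^ 2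
        ≤ ∑ j : Fin k, P.lagrangeAtZero k (j + 1) ^ 2 := by
          refine Finset.sum_le_sum fun j _ => mul_le_of_le_one_left (sq_nonneg _) ?_
          rw [sq_le_one_iff_abs_le_one, abs_div]
          exact div_le_one_of_le₀ (P.abs_c_anti (by omega) (by omega) (by omega)) (abs_nonneg _)
      _ ≤ Real.exp (b * (ρ ^ 2)⁻¹) * (1 + z * (ρ ^ 2)⁻¹) :=
          h.sum_sq_lagrangeAtZero_le hδ hδ1 h1 (by omega)
      _ ≤ _ := by
          gcongr
          exact Real.exp_mul_le_one_add hb0 ht.le ht1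
  refine (P.eta_le h1 hk zero_le_one hS hT).trans ?_
  rw [mul_one]
  refine mul_le_mul_of_nonneg_left (sqrt_prod_one_add_mul_le hx0.le hy0 hz0 ht.le ht1) ?_
  exact mul_nonneg (zero_le_one.trans (P.one_le_xi k)) (by positivity)

/-! ### Moderately and mildly ill-posed problems. -/

theorem sum_range_rpow_neg_le {s : ℝ} (hs : 1 < s) {k : ℕ} (hk : 1 ≤ k) (N : ℕ) :
    ∑ i ∈ Finset.range N, ((k + i + 1 : ℕ) : ℝ) ^ (-s) ≤ (k : ℝ) ^ (1 - s) / (s - 1) := by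
  have hk0 : (0 : ℝ) < k := by exact_mod_cast hk
  have hanti : AntitoneOn (fun x : ℝ => x ^ (-s)) (Set.Icc (k : ℝ) (k + N)) := by
    intro x hx y _ hxy
    exact Real.rpow_le_rpow_of_nonpos (hk0.trans_le hx.1) hxy (by linarith)
  have h1 := hanti.sum_le_integral
  have h2 : ∫ x : ℝ in (k : ℝ)..k + N, x ^ (-s)
      = (((k : ℝ) + N) ^ (-s + 1) - (k : ℝ) ^ (-s + 1)) / (-s + 1) := by
    refine integral_rpow (Or.inr ⟨by linarith, ?_⟩)
    rw [Set.uIcc_of_le (by linarith [(Nat.cast_nonneg N : (0 : ℝ) ≤ N)])]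
    exact fun h => absurd h.1 (not_le.2 hk0)
  rw [h2] at h1
  have h3 : (0 : ℝ) ≤ ((k : ℝ) + N) ^ (-s + 1) := by positivity
  calc ∑ i ∈ Finset.range N, ((k + i + 1 : ℕ) : ℝ) ^ (-s)
      = ∑ i ∈ Finset.range N, ((k : ℝ) + ((i + 1 : ℕ) : ℝ)) ^ (-s) :=
        Finset.sum_congr rfl fun i _ => by push_cast; ring_nf
    _ ≤ (((k : ℝ) + N) ^ (-s + 1) - (k : ℝ) ^ (-s + 1)) / (-s + 1) := h1
    _ = ((k : ℝ) ^ (1 - s) - ((k : ℝ) + N) ^ (-s + 1)) / (s - 1) := by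
        rw [show -s + 1 = -(s - 1) by ring, show 1 - s = -(s - 1) by ring, div_neg, ← neg_div,
          neg_sub]
    _ ≤ _ := by
        refine div_le_div_of_nonneg_right ?_ (by linarith)
        linarith

/-- The integral over `[0, k]` dominates the terms below `k`; the last term is added separately and
yields the `+ 1` in the coefficient sums below. -/
theorem sum_range_rpow_le {s : ℝ} (hs : 0 < s) (k : ℕ) :
    ∑ i ∈ Finset.range k, ((i + 1 : ℕ) : ℝ) ^ s ≤ (k : ℝ) ^ (s + 1) / (s + 1) + (k : ℝ) ^ s := by
  have hmono : MonotoneOn (fun x : ℝ => x ^ s) (Set.Icc (0 : ℝ) (0 + k)) := by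
    intro x hx y _ hxy
    exact Real.rpow_le_rpow hx.1 hxy hs.le
  have h1 := hmono.sum_le_integral
  rw [integral_rpow (Or.inl (by linarith))] at h1
  simp only [zero_add, Real.zero_rpow (by linarith : s + 1 ≠ 0), sub_zero] at h1
  have h2 := Finset.sum_range_succ' (fun i : ℕ => (i : ℝ) ^ s) k
  rw [Finset.sum_range_succ, Nat.cast_zero, Real.zero_rpow hs.ne', add_zero] at h2
  linarith

namespace IllPosedProblem

variable {m n : ℕ} (P : IllPosedProblem m n)

/-- The ratio equals `(σ_k/σ_j)^{1+β}` with base at most `1`, so the unknown `β > 0` can be dropped.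
-/
theorem abs_c_div_le {j k : ℕ} (h1 : 1 ≤ j) (hjk : j ≤ k) (hk : k ≤ P.k₀) :
    |P.c k| / |P.c j| ≤ P.σ k / P.σ j := by
  have hn := P.k₀_le
  have hσj := P.svd.pos j h1 (by omega)
  have hσk := P.svd.pos k (by omega) (by omega)
  have hc : ∀ i, 1 ≤ i → i ≤ P.k₀ → |P.c i| = P.σ i ^ (1 + P.β) := fun i hi hik =>
    (P.coeff_signal i hi hik).trans (P.picard i hi (by omega))
  rw [hc k (by omega) hk, hc j h1 (by omega), ← Real.div_rpow hσk.le hσj.le]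
  have h2 : P.σ k / P.σ j ≤ 1 := div_le_one_of_le₀ (P.σ_anti h1 hjk (by omega)) hσj.le
  calc (P.σ k / P.σ j) ^ (1 + P.β) ≤ (P.σ k / P.σ j) ^ (1 : ℝ) :=
        Real.rpow_le_rpow_of_exponent_ge (by positivity) h2 (by linarith [P.β_pos])
    _ = _ := Real.rpow_one _

theorem lagrangeAtZero_le_lagrangeMax {k : ℕ} (j : Fin k) :
    P.lagrangeAtZero k (j + 1) ≤ P.lagrangeMax k :=
  le_ciSup (f := fun j : Fin k => P.lagrangeAtZero k (j + 1)) (Set.finite_range _).bddAbove j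

theorem sum_mul_sq_lagrangeAtZero_le {k : ℕ} {v : ℝ}
    (hv : ∑ j : Fin k, (P.c k / P.c (j + 1)) ^ 2 ≤ v) :
    ∑ j : Fin k, (P.c k / P.c (j + 1)) ^ 2 * P.lagrangeAtZero k (j + 1) ^ 2
      ≤ v * P.lagrangeMax k ^ 2 := by
  refine le_trans ?_ (mul_le_mul_of_nonneg_right hv (sq_nonneg _))
  rw [Finset.sum_mul]
  refine Finset.sum_le_sum fun j _ => mul_le_mul_of_nonneg_left ?_ (sq_nonneg _)
  exact pow_le_pow_left₀ (P.lagrangeAtZero_nonneg _ _) (P.lagrangeAtZero_le_lagrangeMax j) 2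

theorem lagrangeMax_nonneg (k : ℕ) : 0 ≤ P.lagrangeMax k :=
  Real.iSup_nonneg fun _ => P.lagrangeAtZero_nonneg _ _

namespace IsModerateOrMild

variable {P} {ζ α : ℝ}

/-- Integrating `x^{-2α}` from `k` gives `σ_k² k/(2α - 1)`. Measured against `σ_{k+1}²`, this
produces the factor `σ_k/σ_{k+1}` of the theorem. -/
theorem sum_sq_tail_le (h : P.IsModerateOrMild ζ α) {k : ℕ} (h1 : 1 ≤ k) (hk : k + 1 ≤ n) :
    ∑ i : Fin (n - k), P.σ (k + i + 1) ^ 2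
      ≤ P.σ (k + 1) ^ 2 * ((P.σ k / P.σ (k + 1)) ^ 2 * (k / (2 * α - 1))) := by
  have hα := h.half_lt
  have hk0 : (0 : ℝ) < k := by exact_mod_cast h1
  have hσ : 0 < P.σ (k + 1) := P.svd.pos _ (by omega) hk
  have hsq : ∀ j : ℕ, 1 ≤ j → j ≤ n → P.σ j ^ 2 = ζ ^ 2 * (j : ℝ) ^ (-(2 * α)) := by
    intro j hj hjn
    rw [h.eq j hj hjn, mul_pow, ← Real.rpow_natCast ((j : ℝ) ^ (-α)),
      ← Real.rpow_mul (by positivity)]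
    congr 2
    push_cast
    ring
  have h2 : P.σ (k + 1) ^ 2 * ((P.σ k / P.σ (k + 1)) ^ 2 * (k / (2 * α - 1)))
      = ζ ^ 2 * ((k : ℝ) ^ (1 - 2 * α) / (2 * α - 1)) := by
    rw [show 1 - 2 * α = -(2 * α) + 1 by ring, Real.rpow_add hk0, Real.rpow_one, div_pow,
      ← mul_assoc, mul_div_cancel₀ _ (by positivity), hsq k h1 (by omega)]
    ring
  rw [h2, Fin.sum_univ_eq_sum_range (fun i => P.σ (k + i + 1) ^ 2)]
  calc ∑ i ∈ Finset.range (n - k), P.σ (k + i + 1) ^ 2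
      = ζ ^ 2 * ∑ i ∈ Finset.range (n - k), ((k + i + 1 : ℕ) : ℝ) ^ (-(2 * α)) := by
        rw [Finset.mul_sum]
        refine Finset.sum_congr rfl fun i hi => ?_
        have := Finset.mem_range.1 hi
        exact hsq _ (by omega) (by omega)
    _ ≤ _ := mul_le_mul_of_nonneg_left (sum_range_rpow_neg_le (by linarith) h1 _) (sq_nonneg _)

theorem sum_sq_c_div_le (h : P.IsModerateOrMild ζ α) {k : ℕ} (h1 : 1 ≤ k) (hk : k ≤ P.k₀) :
    ∑ i ∈ Finset.range k, (P.c k / P.c (i + 1)) ^ 2 ≤ k / (2 * α + 1) + 1 := by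
  have hα := h.half_lt
  have hn := P.k₀_le
  have hk0 : (0 : ℝ) < k := by exact_mod_cast h1
  have hζ := h.ζ_pos
  have hterm : ∀ i ∈ Finset.range k, (P.c k / P.c (i + 1)) ^ 2
      ≤ (k : ℝ) ^ (-(2 * α)) * ((i + 1 : ℕ) : ℝ) ^ (2 * α) := by
    intro i hi
    have hi' := Finset.mem_range.1 hi
    have hi0 : (0 : ℝ) < ((i + 1 : ℕ) : ℝ) := by positivity
    have h2 := pow_le_pow_left₀ (by positivity)
      (P.abs_c_div_le (j := i + 1) (k := k) (by omega) (by omega) hk) 2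
    rw [← abs_div, sq_abs, h.eq k h1 (by omega), h.eq (i + 1) (by omega) (by omega),
      mul_div_mul_left _ _ hζ.ne', Real.rpow_neg hi0.le α, div_inv_eq_mul, mul_pow,
      ← Real.rpow_natCast ((k : ℝ) ^ (-α)), ← Real.rpow_mul hk0.le,
      ← Real.rpow_natCast (((i + 1 : ℕ) : ℝ) ^ α), ← Real.rpow_mul hi0.le] at h2
    refine h2.trans (le_of_eq ?_)
    congr 2 <;> push_cast <;> ring
  calc ∑ i ∈ Finset.range k, (P.c k / P.c (i + 1)) ^ 2
      ≤ ∑ i ∈ Finset.range k, (k : ℝ) ^ (-(2 * α)) * ((i + 1 : ℕ) : ℝ) ^ (2 * α) :=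
        Finset.sum_le_sum hterm
    _ = (k : ℝ) ^ (-(2 * α)) * ∑ i ∈ Finset.range k, ((i + 1 : ℕ) : ℝ) ^ (2 * α) := by
        rw [Finset.mul_sum]
    _ ≤ (k : ℝ) ^ (-(2 * α)) * ((k : ℝ) ^ (2 * α + 1) / (2 * α + 1) + (k : ℝ) ^ (2 * α)) :=
        mul_le_mul_of_nonneg_left (sum_range_rpow_le (by linarith) k) (by positivity)
    _ = _ := by
        rw [mul_add, ← mul_div_assoc, ← Real.rpow_add hk0, ← Real.rpow_add hk0, neg_add_cancel,
          Real.rpow_zero, neg_add_cancel_left, Real.rpow_one]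

/-- For `j ≤ k₀`, replace `c_k` by the larger `c_{k₀}` and use the signal estimate; each of the
other `k - k₀` terms is at most `1`. -/
theorem sum_sq_c_div_le_of_lt (h : P.IsModerateOrMild ζ α) {k : ℕ} (hk : P.k₀ < k) (hn : k ≤ n) :
    ∑ i ∈ Finset.range k, (P.c k / P.c (i + 1)) ^ 2
      ≤ P.k₀ / (2 * α + 1) + 1 + (k - P.k₀) := by
  have h1 := P.one_le_k₀
  obtain ⟨N, rfl⟩ : ∃ N, k = P.k₀ + N := ⟨k - P.k₀, by omega⟩
  rw [Finset.sum_range_add]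
  refine add_le_add ?_ ?_
  · refine (Finset.sum_le_sum fun i _ => ?_).trans (h.sum_sq_c_div_le h1 le_rfl)
    rw [div_pow, div_pow]
    exact div_le_div_of_nonneg_right (sq_le_sq.2 (P.abs_c_anti h1 (by omega) hn)) (sq_nonneg _)
  · calc ∑ i ∈ Finset.range N, (P.c (P.k₀ + N) / P.c (P.k₀ + i + 1)) ^ 2
        ≤ ∑ i ∈ Finset.range N, (1 : ℝ) := by
          refine Finset.sum_le_sum fun i hi => ?_
          have := Finset.mem_range.1 hi
          rw [sq_le_one_iff_abs_le_one, abs_div]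
          exact div_le_one_of_le₀ (P.abs_c_anti (by omega) (by omega) hn) (abs_nonneg _)
      _ = _ := by simp

theorem eta_one_le (h : P.IsModerateOrMild ζ α) (hn : 2 ≤ n) :
    P.eta 1 ≤ P.xi 1 * (P.σ 1 / P.σ 2) * (|P.c 2| / |P.c 1|) * Real.sqrt (1 / (2 * α - 1)) := by
  have hr : 0 ≤ P.σ 1 / P.σ (1 + 1) :=
    div_nonneg (P.svd.pos _ le_rfl (by omega)).le (P.svd.pos _ (by omega) hn).le
  -- For `k = 1` the Lagrange product is empty, so the sum is exactly `1` and the integral estimate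
  -- is not needed.
  have hT : ∑ j : Fin 1, (P.c 1 / P.c (j + 1)) ^ 2 * P.lagrangeAtZero 1 (j + 1) ^ 2 ≤ 1 := by
    simp [lagrangeAtZero, div_self (P.c_ne_zero le_rfl (by omega : 1 ≤ n))]
  simpa using P.eta_le le_rfl hn hr (h.sum_sq_tail_le le_rfl hn) hT

theorem eta_le (h : P.IsModerateOrMild ζ α) {k : ℕ} (h1 : 1 ≤ k) (hk : k + 1 ≤ n) {v : ℝ}
    (hv : ∑ i ∈ Finset.range k, (P.c k / P.c (i + 1)) ^ 2 ≤ v) :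
    P.eta k ≤ P.xi k * (P.σ k / P.σ (k + 1)) * (|P.c (k + 1)| / |P.c k|)
      * Real.sqrt (k / (2 * α - 1) * v) * P.lagrangeMax k := by
  have hr : 0 ≤ P.σ k / P.σ (k + 1) :=
    div_nonneg (P.svd.pos _ h1 (by omega)).le (P.svd.pos _ (by omega) hk).le
  rw [← Fin.sum_univ_eq_sum_range (fun i => (P.c k / P.c (i + 1)) ^ 2)] at hv
  refine (P.eta_le h1 hk hr (h.sum_sq_tail_le h1 hk)
    (P.sum_mul_sq_lagrangeAtZero_le hv)).trans (le_of_eq ?_)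
  rw [← mul_assoc (_ / _) v, Real.sqrt_mul' _ (sq_nonneg _), Real.sqrt_sq (P.lagrangeMax_nonneg k)]
  ring

end IsModerateOrMild

end IllPosedProblem

theorem mainTheorem1 :
    -- the two-sided bound for `γ_k`, and the value of `ξ_k`
    (∀ (m n : ℕ) (P : IllPosedProblem m n) (k : ℕ), 1 ≤ k → k + 1 ≤ n →
      P.σ (k + 1) ≤ P.gamma k ∧
      P.gamma k ≤ Real.sqrt (1 + P.eta k ^ 2) * P.σ (k + 1) ∧
      (‖P.Delta k‖ < 1 →
        P.xi k = Real.sqrt ((‖P.Delta k‖ / (1 + ‖P.Delta k‖ ^ 2)) ^ 2 + 1)) ∧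
      (1 ≤ ‖P.Delta k‖ → P.xi k ≤ Real.sqrt 5 / 2)) ∧
    -- severely ill-posed problems; the constant `C` in `𝒪(ρ^{-2})` depends on `κ` and `δ` only
    (∀ κ δ : ℝ, 1 ≤ κ → 0 < δ → δ < 1 → ∃ C : ℝ, 0 < C ∧
      ∀ (m n : ℕ) (P : IllPosedProblem m n) (ρ : ℝ), P.IsSevere ρ κ δ →
        ∀ k : ℕ, 1 ≤ k → k + 1 ≤ n →
          (k ≤ P.k₀ →
            P.eta k ≤ P.xi k * (|P.c (k + 1)| / |P.c k|) * (1 + C * (ρ ^ 2)⁻¹)) ∧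
          (P.k₀ < k →
            P.eta k ≤ P.xi k * Real.sqrt ((k : ℝ) - P.k₀ + 1) * (1 + C * (ρ ^ 2)⁻¹))) ∧
    -- moderately and mildly ill-posed problems
    (∀ (m n : ℕ) (P : IllPosedProblem m n) (ζ α : ℝ), P.IsModerateOrMild ζ α →
      ∀ k : ℕ, 1 ≤ k → k + 1 ≤ n →
        (k = 1 →
          P.eta k ≤ P.xi 1 * (P.σ 1 / P.σ 2) * (|P.c 2| / |P.c 1|)
            * Real.sqrt (1 / (2 * α - 1))) ∧
        (1 < k → k ≤ P.k₀ →
          P.eta k ≤ P.xi k * (P.σ k / P.σ (k + 1)) * (|P.c (k + 1)| / |P.c k|)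
            * Real.sqrt ((k : ℝ) ^ 2 / (4 * α ^ 2 - 1) + (k : ℝ) / (2 * α - 1))
            * P.lagrangeMax k) ∧
        (P.k₀ < k →
          P.eta k ≤ P.xi k * (P.σ k / P.σ (k + 1))
            * Real.sqrt ((k : ℝ) * P.k₀ / (4 * α ^ 2 - 1)
                + (k : ℝ) * ((k : ℝ) - P.k₀ + 1) / (2 * α - 1))
            * P.lagrangeMax k)) := by
  refine ⟨fun m n P k _ hk => ⟨P.le_gamma hk, P.gamma_le hk, P.xi_eq, fun _ => P.xi_le k⟩, ?_, ?_⟩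
  · intro κ δ _ hδ hδ1
    obtain ⟨C, hC, h⟩ := IllPosedProblem.exists_eta_le_of_isSevere κ hδ hδ1
    refine ⟨C, hC, fun m n P ρ hP k h1 hk => ⟨fun _ => h m n P ρ hP k h1 hk, fun hk0 => ?_⟩⟩
    refine (h m n P ρ hP k h1 hk).trans ?_
    have ht := hP.inv_sq_pos
    have hxi : 0 ≤ P.xi k := zero_le_one.trans (P.one_le_xi k)
    -- Past `k₀` the coefficient ratio is `η/η = 1`; the stated square root only has to be at least
    -- `1`.
    rw [P.abs_c_eq_η (by omega) hk, P.abs_c_eq_η hk0 (by omega), div_self P.η_pos.ne']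
    gcongr
    rw [Real.one_le_sqrt]
    have : (P.k₀ : ℝ) ≤ k := by exact_mod_cast hk0.le
    linarith
  · intro m n P ζ α h k h1 hk
    have hα := h.half_lt
    have hm : 2 * α - 1 ≠ 0 := by linarith
    have hp : 2 * α + 1 ≠ 0 := by linarith
    have hmp : 4 * α ^ 2 - 1 = (2 * α - 1) * (2 * α + 1) := by ring
    refine ⟨?_, fun _ hk0 => ?_, fun hk0 => ?_⟩
    · rintro rfl
      exact h.eta_one_le hk
    · refine (h.eta_le h1 hk (h.sum_sq_c_div_le h1 hk0)).trans (le_of_eq ?_)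
      -- `(k/(2α-1))(k/(2α+1) + 1)` is the stated radicand, as `(2α-1)(2α+1) = 4α² - 1`.
      congr 3
      rw [hmp]
      field_simp
    · refine (h.eta_le h1 hk (h.sum_sq_c_div_le_of_lt hk0 (by omega))).trans (le_of_eq ?_)
      rw [P.abs_c_eq_η (by omega) hk, P.abs_c_eq_η hk0 (by omega), div_self P.η_pos.ne', mul_one]
      congr 3
      rw [hmp]
      field_simp
      ring
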